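/- Let $d\ge 0$ be an integer, $\mathcal S(\mathbb R^d)$ the Schwartz space (of real- or complex-valued functions; the Hilbert spaces below are taken over the same field $\mathbb K\in\{\mathbb R,\mathbb C\}$), $L_0=\Delta-x\cdot\nabla$ with domain $D(L_0)=\mathcal S(\mathbb R^d)$, and $\mu(dx)=\rho(x)\,dx$ with $\rho(x)=(2\pi)^{-d/2}e^{-|x|^2/2}$. Then: 1. $L_0$ is densely defined in $L^2(\mathbb R^d,dx)$ and its adjoint there is $\Delta+x\cdot\nabla+d$. That is, the adjoint extends the operator $\Delta+x\cdot\nabla+d$ on $\mathcal S(\mathbb R^d)$, and, for $g,h\in L^2(\mathbb R^d,dx)$, one has $g\in D(L_0^*)$ and $L_0^*g=h$ if and only if $\Delta g+x\cdot\nabla g+d\,g=h$ in the sense of tempered distributions. 2. $\mu$ is $(L_0,\mathcal S(\mathbb R^d))$-invariant: $\mathcal S(\mathbb R^d)$ is dense in $L^2(\mathbb R^d,\mu)$, and for every $f\in\mathcal S(\mathbb R^d)$ the function $L_0f$ is $\mu$-integrable and $\int L_0f\,d\mu=0$. 3. The adjoint of $(L_0,\mathcal S(\mathbb R^d))$ in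 $L^2(\mathbb R^d,\mu)$ is equal to $L_0$ on $\mathcal S(\mathbb R^d)$; thus $L_0$ is symmetric in $L^2(\mathbb R^d,\mu)$. 4. $(L_0,\mathcal S(\mathbb R^d))$ is closable in $L^2(\mathbb R^d,\mu)$ and its closure $\overline L_0$ is self-adjoint. 5. $\overline L_0$ is the infinitesimal generator of exactly one strongly continuous contraction semigroup $(e^{t\overline L_0})_{t\ge 0}$ in $L^2(\mathbb R^d,\mu)$, and $\mu$ is invariant under it: $\int e^{t\overline L_0}f\,d\mu=\int f\,d\mu$ for all $t\ge0$ and all $f\in L^2(\mathbb R^d,\mu)$. -/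

import Mathlib

open MeasureTheory Filter
open scoped SchwartzMap Laplacian LineDeriv Topology ENNReal NNReal

noncomputable section

namespace OrnsteinUhlenbeck

/-- The space `ℝ^d` with its Euclidean norm. -/
abbrev Rd (d : ℕ) : Type := EuclideanSpace ℝ (Fin d)

/-- The `i`-th standard basis vector of `ℝ^d`. -/
abbrev basisVec {d : ℕ} (i : Fin d) : Rd d := EuclideanSpace.single i (1 : ℝ)

section Measure

/-- The standard Gaussian density `ρ(x) = exp(-|x|²/2) / (2π)^(d/2)`. -/
def rho (d : ℕ) (x : Rd d) : ℝ :=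
  Real.exp (-‖x‖ ^ 2 / 2) / (2 * Real.pi) ^ ((d : ℝ) / 2)

/-- The measure `μ(dx) = ρ(x) dx` on `ℝ^d`. -/
def gauss (d : ℕ) : Measure (Rd d) :=
  (volume : Measure (Rd d)).withDensity fun x => ENNReal.ofReal (rho d x)

theorem rho_pos (d : ℕ) (x : Rd d) : 0 < rho d x := by
  unfold rho
  positivity

theorem continuous_rho (d : ℕ) : Continuous (rho d) := by
  unfold rho
  fun_prop

theorem integral_rho (d : ℕ) : ∫ x, rho d x = 1 := by
  have h := GaussianFourier.integral_rexp_neg_mul_sq_norm (V := Rd d)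
    (show (0 : ℝ) < 1 / 2 by norm_num)
  have h2 : (fun x : Rd d => rho d x) = fun x =>
      Real.exp (-(1 / 2) * ‖x‖ ^ 2) / (2 * Real.pi) ^ ((d : ℝ) / 2) := by
    funext x
    unfold rho
    congr 2
    ring
  have h3 : Real.pi / (1 / 2) = 2 * Real.pi := by ring
  have h4 : (0 : ℝ) < (2 * Real.pi) ^ ((d : ℝ) / 2) := by positivity
  rw [h2, integral_div, h, h3, finrank_euclideanSpace_fin]
  exact div_self h4.ne'

instance isProbabilityMeasure_gauss (d : ℕ) : IsProbabilityMeasure (gauss d) := by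
  have hint : Integrable (rho d) := by
    by_contra hn
    have := integral_undef hn
    rw [integral_rho] at this
    exact one_ne_zero this
  constructor
  rw [gauss, withDensity_apply _ MeasurableSet.univ, Measure.restrict_univ,
    ← ofReal_integral_eq_lintegral_ofReal hint (ae_of_all _ fun x => (rho_pos d x).le),
    integral_rho, ENNReal.ofReal_one]

instance isOpenPosMeasure_gauss (d : ℕ) : (gauss d).IsOpenPosMeasure := by
  have h : (volume : Measure (Rd d)) ≪ gauss d := by
    refine withDensity_absolutelyContinuous' ?_ ?_
    · exact ((continuous_rho d).measurable.ennreal_ofReal).aemeasurable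
    · exact ae_of_all _ fun x => by simp [rho_pos d x]
  exact h.isOpenPosMeasure

end Measure

section Operators

variable (𝕜 : Type*) [RCLike 𝕜] (d : ℕ)

/-- The operator `f ↦ x · ∇f = ∑ᵢ xᵢ ∂ᵢ f` on the Schwartz space `S(ℝ^d)`. -/
def eulerOp : 𝓢(Rd d, 𝕜) →ₗ[𝕜] 𝓢(Rd d, 𝕜) :=
  ∑ i : Fin d, (SchwartzMap.smulLeftCLM 𝕜 (fun x : Rd d => ((x i : ℝ) : 𝕜))).toLinearMap ∘ₗ
    (LineDeriv.lineDerivOpCLM 𝕜 𝓢(Rd d, 𝕜) (basisVec i)).toLinearMap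

/-- The Laplacian on the Schwartz space, as a linear map. -/
def lapOp : 𝓢(Rd d, 𝕜) →ₗ[𝕜] 𝓢(Rd d, 𝕜) :=
  (LineDeriv.laplacianCLM 𝕜 (Rd d) 𝓢(Rd d, 𝕜)).toLinearMap

/-- The operator `Δ - x · ∇` on the Schwartz space. -/
def ouOp : 𝓢(Rd d, 𝕜) →ₗ[𝕜] 𝓢(Rd d, 𝕜) := lapOp 𝕜 d - eulerOp 𝕜 d

/-- The operator `Δ + x · ∇ + d` on the Schwartz space. -/
def ouDualOp : 𝓢(Rd d, 𝕜) →ₗ[𝕜] 𝓢(Rd d, 𝕜) :=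
  lapOp 𝕜 d + eulerOp 𝕜 d + (d : 𝕜) • LinearMap.id

variable {𝕜 d}

theorem lapOp_apply (f : 𝓢(Rd d, 𝕜)) (x : Rd d) : lapOp 𝕜 d f x = Δ (f : Rd d → 𝕜) x := by
  rw [← SchwartzMap.laplacian_apply, ← SchwartzMap.laplacianCLM_eq (𝕜 := 𝕜)]
  rfl

theorem eulerOp_apply (f : 𝓢(Rd d, 𝕜)) (x : Rd d) :
    eulerOp 𝕜 d f x = fderiv ℝ (f : Rd d → 𝕜) x x := by
  have hg : ∀ i : Fin d, Function.HasTemperateGrowth fun x : Rd d => ((x i : ℝ) : 𝕜) := by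
    intro i
    exact ((RCLike.ofRealCLM (K := 𝕜)).comp
      (EuclideanSpace.proj i : Rd d →L[ℝ] ℝ)).hasTemperateGrowth
  have hx : ∑ i : Fin d, x i • basisVec i = x := by
    simpa using (EuclideanSpace.basisFun (Fin d) ℝ).sum_repr x
  have hsum : fderiv ℝ (f : Rd d → 𝕜) x x =
      ∑ i : Fin d, fderiv ℝ (f : Rd d → 𝕜) x (x i • basisVec i) := by
    rw [← map_sum, hx]
  rw [hsum]
  simp only [eulerOp, LinearMap.sum_apply, _root_.sum_apply]
  refine Finset.sum_congr rfl fun i _ => ?_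
  change SchwartzMap.smulLeftCLM 𝕜 (fun x : Rd d => ((x i : ℝ) : 𝕜)) (∂_{basisVec i} f) x = _
  rw [SchwartzMap.smulLeftCLM_apply_apply (hg i), SchwartzMap.lineDerivOp_apply_eq_fderiv,
    map_smul, smul_eq_mul, RCLike.real_smul_eq_coe_mul]

theorem ouOp_apply (f : 𝓢(Rd d, 𝕜)) (x : Rd d) :
    ouOp 𝕜 d f x = Δ (f : Rd d → 𝕜) x - fderiv ℝ (f : Rd d → 𝕜) x x := by
  rw [← lapOp_apply, ← eulerOp_apply]
  rfl

theorem ouDualOp_apply (f : 𝓢(Rd d, 𝕜)) (x : Rd d) :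
    ouDualOp 𝕜 d f x =
      Δ (f : Rd d → 𝕜) x + fderiv ℝ (f : Rd d → 𝕜) x x + (d : 𝕜) * f x := by
  rw [← lapOp_apply, ← eulerOp_apply]
  rfl

section Lp

variable (ν : Measure (Rd d)) [ν.HasTemperateGrowth] [ν.IsOpenPosMeasure]

/-- The (injective) inclusion of the Schwartz space in `L²(ν)`. -/
def schwartzToL2 : 𝓢(Rd d, 𝕜) →ₗ[𝕜] Lp 𝕜 2 ν := (SchwartzMap.toLpCLM 𝕜 𝕜 2 ν).toLinearMap

theorem schwartzToL2_injective :
    Function.Injective (schwartzToL2 ν : 𝓢(Rd d, 𝕜) →ₗ[𝕜] Lp 𝕜 2 ν) :=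
  SchwartzMap.injective_toLp 2 ν

/-- A linear operator `A : S(ℝ^d) → S(ℝ^d)`, seen as an unbounded operator in `L²(ν)` whose domain
is (the image of) `S(ℝ^d)`. -/
def onSchwartz (A : 𝓢(Rd d, 𝕜) →ₗ[𝕜] 𝓢(Rd d, 𝕜)) : Lp 𝕜 2 ν →ₗ.[𝕜] Lp 𝕜 2 ν where
  domain := LinearMap.range (schwartzToL2 ν : 𝓢(Rd d, 𝕜) →ₗ[𝕜] Lp 𝕜 2 ν)
  toFun := schwartzToL2 ν ∘ₗ A ∘ₗ
    (LinearEquiv.ofInjective (schwartzToL2 ν) (schwartzToL2_injective ν)).symm.toLinearMap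

theorem onSchwartz_apply (A : 𝓢(Rd d, 𝕜) →ₗ[𝕜] 𝓢(Rd d, 𝕜)) (f : 𝓢(Rd d, 𝕜)) :
    onSchwartz ν A ⟨schwartzToL2 ν f, LinearMap.mem_range_self _ f⟩ = schwartzToL2 ν (A f) := by
  have h : (LinearEquiv.ofInjective (schwartzToL2 ν) (schwartzToL2_injective ν)).symm
      ⟨schwartzToL2 ν f, LinearMap.mem_range_self _ f⟩ = f := by
    rw [LinearEquiv.symm_apply_eq]
    rfl
  change schwartzToL2 ν (A ((LinearEquiv.ofInjective (schwartzToL2 ν)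
    (schwartzToL2_injective ν)).symm ⟨schwartzToL2 ν f, LinearMap.mem_range_self _ f⟩)) = _
  rw [h]

end Lp

/-- For `g, h ∈ L²(dx)`: the equation `Δg + x · ∇g + d g = h` holds in the sense of (tempered)
distributions. Tested against `φ`, the distribution `Δg` gives `∫ g Δφ`, the distribution
`xᵢ ∂ᵢ g` gives `-∫ g ∂ᵢ(xᵢ φ)`, and `d g` gives `d ∫ g φ`. -/
def SolvesDualWeakly (g h : Lp 𝕜 2 (volume : Measure (Rd d))) : Prop :=
  ∀ φ : 𝓢(Rd d, 𝕜),
    (∫ x, g x * Δ (φ : Rd d → 𝕜) x)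
      - (∑ i : Fin d, ∫ x, g x * lineDeriv ℝ (fun y : Rd d => ((y i : ℝ) : 𝕜) * φ y) x (basisVec i))
      + (d : 𝕜) * (∫ x, g x * φ x)
    = ∫ x, h x * φ x

end Operators

section Semigroups

variable {𝕜 : Type*} [RCLike 𝕜]

/-- Strongly continuous one-parameter contraction semigroups on a normed space. -/
structure IsC0ContractionSemigroup {H : Type*} [NormedAddCommGroup H] [NormedSpace 𝕜 H]
    (T : ℝ≥0 → H →L[𝕜] H) : Prop where
  zero : T 0 = ContinuousLinearMap.id 𝕜 H
  add : ∀ s t, T (s + t) = (T s).comp (T t)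
  continuous : ∀ x, Continuous fun t => T t x
  contraction : ∀ t, ‖T t‖ ≤ 1

/-- `A` is the infinitesimal generator of `T`: `x ∈ D(A)` and `A x = y` if and only if
`(T t x - x) / t` converges to `y` in norm as `t ↓ 0`. -/
def IsGenerator {H : Type*} [NormedAddCommGroup H] [NormedSpace 𝕜 H]
    (A : H →ₗ.[𝕜] H) (T : ℝ≥0 → H →L[𝕜] H) : Prop :=
  ∀ x y : H, (x, y) ∈ A.graph ↔
    Tendsto (fun t : ℝ≥0 => (((t : ℝ)⁻¹ : ℝ) : 𝕜) • (T t x - x)) (𝓝[>] 0) (𝓝 y)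

variable {X : Type*} [MeasurableSpace X]

/-- `μ` is `(A, D(A))`-invariant: the operator `A` in `L²(μ)` is densely defined and
`∫ A f dμ = 0` for all `f ∈ D(A)`. -/
def IsOperatorInvariant (μ : Measure X) (A : Lp 𝕜 2 μ →ₗ.[𝕜] Lp 𝕜 2 μ) : Prop :=
  Dense (A.domain : Set (Lp 𝕜 2 μ)) ∧
    ∀ f : A.domain, Integrable (A f : X → 𝕜) μ ∧ ∫ x, (A f : X → 𝕜) x ∂μ = 0

/-- `μ` is invariant under the operators `T t` in `L²(μ)`: `∫ T t f dμ = ∫ f dμ` for all `t` and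
all `f ∈ L²(μ)`. -/
def IsSemigroupInvariant (μ : Measure X) (T : ℝ≥0 → Lp 𝕜 2 μ →L[𝕜] Lp 𝕜 2 μ) : Prop :=
  ∀ (t : ℝ≥0) (f : Lp 𝕜 2 μ), Integrable (T t f : X → 𝕜) μ ∧ Integrable (f : X → 𝕜) μ ∧
    ∫ x, (T t f : X → 𝕜) x ∂μ = ∫ x, (f : X → 𝕜) x ∂μ

/-- A densely defined operator is symmetric if its adjoint extends it. -/
def IsSymmetricOp {H : Type*} [NormedAddCommGroup H] [InnerProductSpace 𝕜 H] [CompleteSpace H]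
    (A : H →ₗ.[𝕜] H) : Prop :=
  Dense (A.domain : Set H) ∧ A ≤ A.adjoint

end Semigroups

end OrnsteinUhlenbeck

end

open OrnsteinUhlenbeck

/-! The adjoint in `L²(dx)` comes from testing. Since `L₀` has real coefficients, membership in the
graph of the adjoint is a bilinear identity against all Schwartz functions, and `∂ᵢ(xᵢ φ) = φ + xᵢ
∂ᵢφ`, summed over `i`, accounts for the term `d`.

For the Gaussian measure, `∂ᵢρ = -xᵢρ` gives `∫ ∂ᵢw dμ = ∫ xᵢw dμ` (`integral_lineDerivOp_gauss`).
With `w = ∂ᵢf` this yields `∫ L₀f dμ = 0`; with `w = u ∂ᵢv` it yields `∫ u L₀v dμ = -∑ᵢ ∫ ∂ᵢu ∂ᵢv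
dμ`, hence symmetry, closability and dissipativity.

The substance is that `c - L₀` has dense range for every `c > 0` (`hasDenseRange_ouOp`). On
polynomials, `(c - L₀)⟪a,x⟫ⁿ = (c + n)⟪a,x⟫ⁿ - n(n-1)|a|²⟪a,x⟫ⁿ⁻²`, so all moments of a function
orthogonal to the range vanish by induction on `n`. Polynomials are not Schwartz, so they are cut
off by `χ(s x)` with `s → 0` (`moment_recursion`). Vanishing moments force the function to be zero,
because Gaussian tails let the Fourier transform be expanded in moments (`ae_eq_zero_of_moments`).

Dissipativity turns dense range into `c - L̄₀` being onto (`HasDenseRange.hasFullRange_closure`). A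
symmetric operator with this property is self-adjoint, and a dissipative one generates a contraction
semigroup, here built by Yosida approximation (`exists_contractionSemigroup`). Invariance of `μ`
follows since `⟪1, L̄₀f⟫ = 0` makes `⟪1, T t f⟫` constant in `t`. -/

noncomputable section

namespace OrnsteinUhlenbeck

/-! ### Dissipative operators and orbits of contraction semigroups -/

section HilleYosida

variable {𝕜 : Type*} [RCLike 𝕜] {H : Type*} [NormedAddCommGroup H] [InnerProductSpace 𝕜 H]

/-- A curve whose right derivative has nonpositive inner product with it has nonincreasing norm. -/
theorem norm_le_of_hasDerivWithinAt_of_re_inner_nonpos [NormedSpace ℝ H] {u u' : ℝ → H} {t : ℝ}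
    (ht : 0 ≤ t)
    (hu : ContinuousOn u (Set.Icc 0 t))
    (hd : ∀ s ∈ Set.Ico 0 t, HasDerivWithinAt u (u' s) (Set.Ici s) s)
    (hn : ∀ s ∈ Set.Ico 0 t, RCLike.re (inner 𝕜 (u' s) (u s)) ≤ 0) : ‖u t‖ ≤ ‖u 0‖ := by
  have key : RCLike.re (inner 𝕜 (u t) (u t)) ≤ RCLike.re (inner 𝕜 (u 0) (u 0)) := by
    refine image_le_of_deriv_right_le_deriv_boundary
      (f := fun s => RCLike.re (inner 𝕜 (u s) (u s)))
      (f' := fun s => RCLike.re (inner 𝕜 (u s) (u' s) + inner 𝕜 (u' s) (u s)))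
      (a := 0) (b := t) (B := fun _ => RCLike.re (inner 𝕜 (u 0) (u 0))) (B' := fun _ => 0)
      ?_ ?_ le_rfl continuousOn_const (fun x _ => hasDerivWithinAt_const _ _ _) ?_
      (Set.right_mem_Icc.2 ht)
    · exact RCLike.continuous_re.comp_continuousOn (hu.inner hu)
    · intro s hs
      exact (RCLike.reCLM (K := 𝕜)).hasFDerivAt.comp_hasDerivWithinAt s
        ((hd s hs).inner 𝕜 (hd s hs))
    · intro s hs
      have h := hn s hs
      rw [map_add, inner_re_symm]
      linarith
  rw [inner_self_eq_norm_sq, inner_self_eq_norm_sq] at key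
  exact le_of_sq_le_sq key (norm_nonneg _)

/-- A linear operator with `re ⟪A x, x⟫ ≤ 0` on its domain. -/
def IsDissipative (A : H →ₗ.[𝕜] H) : Prop :=
  ∀ x y : H, (x, y) ∈ A.graph → RCLike.re (inner 𝕜 y x) ≤ 0

/-- `c - A` is onto for all `c > 0`. -/
def HasFullRange (A : H →ₗ.[𝕜] H) : Prop :=
  ∀ c : ℝ, 0 < c → ∀ z : H, ∃ x y : H, (x, y) ∈ A.graph ∧ (c : 𝕜) • x - y = z

/-- Pair `c x - y` with `x` and apply Cauchy–Schwarz. This one estimate gives injectivity of `c -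
A`, the resolvent bound and closedness of the range. -/
theorem IsDissipative.mul_norm_le {A : H →ₗ.[𝕜] H} (hA : IsDissipative A) (c : ℝ)
    {x y : H} (hxy : (x, y) ∈ A.graph) : c * ‖x‖ ≤ ‖(c : 𝕜) • x - y‖ := by
  by_cases hx : x = 0
  · simp [hx]
  have h1 : c * ‖x‖ ^ 2 ≤ RCLike.re (inner 𝕜 ((c : 𝕜) • x - y) x) := by
    rw [inner_sub_left, inner_smul_left, map_sub, RCLike.conj_ofReal, RCLike.re_ofReal_mul,
      inner_self_eq_norm_sq]
    linarith [hA x y hxy]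
  have h2 : RCLike.re (inner 𝕜 ((c : 𝕜) • x - y) x) ≤ ‖(c : 𝕜) • x - y‖ * ‖x‖ :=
    re_inner_le_norm _ _
  have h3 : 0 < ‖x‖ := norm_pos_iff.2 hx
  nlinarith

/-- `T t` is continuous and commutes with the difference quotients at `0`. -/
theorem IsGenerator.mem_graph {T : ℝ≥0 → H →L[𝕜] H} {A : H →ₗ.[𝕜] H}
    (hT : IsC0ContractionSemigroup T) (hA : IsGenerator A T) {x y : H} (hxy : (x, y) ∈ A.graph)
    (t : ℝ≥0) : (T t x, T t y) ∈ A.graph := by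
  rw [hA]
  have h := ((T t).continuous.tendsto y).comp ((hA x y).1 hxy)
  refine h.congr fun s => ?_
  simp only [Function.comp_apply, map_smul, map_sub]
  rw [← ContinuousLinearMap.comp_apply, ← ContinuousLinearMap.comp_apply, ← hT.add, ← hT.add,
    add_comm]

theorem IsC0ContractionSemigroup.continuous_toNNReal {T : ℝ≥0 → H →L[𝕜] H}
    (hT : IsC0ContractionSemigroup T) (x : H) : Continuous fun s : ℝ => T s.toNNReal x :=
  (hT.continuous x).comp continuous_real_toNNReal

section Semigroup

variable [NormedSpace ℝ H] [IsScalarTower ℝ 𝕜 H]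

/-- By the semigroup law, the right difference quotient at `t` is the one at `0` for the vector `T t
x`, which stays in the domain. Only right derivatives are needed below. -/
theorem IsGenerator.hasDerivWithinAt {T : ℝ≥0 → H →L[𝕜] H} {A : H →ₗ.[𝕜] H}
    (hT : IsC0ContractionSemigroup T) (hA : IsGenerator A T) {x y : H} (hxy : (x, y) ∈ A.graph)
    {t : ℝ} (ht : 0 ≤ t) :
    HasDerivWithinAt (fun s : ℝ => T s.toNNReal x) (T t.toNNReal y) (Set.Ici t) t := by
  rw [← hasDerivWithinAt_Ioi_iff_Ici, hasDerivWithinAt_iff_tendsto_slope' Set.self_notMem_Ioi]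
  have h := (hA _ _).1 (hA.mem_graph hT hxy t.toNNReal)
  have h2 : Tendsto (fun s : ℝ => (s - t).toNNReal) (𝓝[>] t) (𝓝[>] 0) := by
    refine tendsto_nhdsWithin_iff.2 ⟨?_, ?_⟩
    · have : Continuous fun s : ℝ => (s - t).toNNReal := by fun_prop
      simpa using (this.tendsto t).mono_left nhdsWithin_le_nhds
    · filter_upwards [self_mem_nhdsWithin] with s hs
      simpa using hs
  refine (h.comp h2).congr' ?_
  filter_upwards [self_mem_nhdsWithin] with s hs
  have hs' : 0 ≤ s - t := by simpa using (le_of_lt hs)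
  have hadd : s.toNNReal = (s - t).toNNReal + t.toNNReal := by
    rw [← Real.toNNReal_add hs' ht, sub_add_cancel]
  rw [slope_def_module, Function.comp_apply, Real.coe_toNNReal _ hs', hadd, hT.add,
    ContinuousLinearMap.comp_apply, RCLike.real_smul_eq_coe_smul (K := 𝕜)]

/-- A dissipative densely defined operator generates at most one contraction semigroup. -/
theorem IsGenerator.unique {T T' : ℝ≥0 → H →L[𝕜] H} {A : H →ₗ.[𝕜] H}
    (hd : Dense (A.domain : Set H)) (hA : IsDissipative A)
    (hT : IsC0ContractionSemigroup T) (hT' : IsC0ContractionSemigroup T') (hAT : IsGenerator A T)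
    (hAT' : IsGenerator A T') : T' = T := by
  have key : ∀ t : ℝ≥0, ∀ x ∈ A.domain, T' t x = T t x := by
    intro t x hx
    obtain ⟨y, hxy⟩ : ∃ y, (x, y) ∈ A.graph := ⟨_, A.mem_graph ⟨x, hx⟩⟩
    -- The difference of the two orbits solves `u' = A u` with `u 0 = 0`, so dissipativity keeps its
    -- norm at `0`.
    have h := norm_le_of_hasDerivWithinAt_of_re_inner_nonpos (𝕜 := 𝕜)
      (u := fun s : ℝ => T' s.toNNReal x - T s.toNNReal x)
      (u' := fun s : ℝ => T' s.toNNReal y - T s.toNNReal y) t.2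
      ((hT'.continuous_toNNReal x).sub (hT.continuous_toNNReal x)).continuousOn
      (fun s hs => (hAT'.hasDerivWithinAt hT' hxy hs.1).sub (hAT.hasDerivWithinAt hT hxy hs.1))
      (fun s hs => hA _ _ (by
        simpa using A.graph.sub_mem (hAT'.mem_graph hT' hxy s.toNNReal)
          (hAT.mem_graph hT hxy s.toNNReal)))
    simpa [hT.zero, hT'.zero, sub_eq_zero] using h
  funext t
  have := Continuous.ext_on hd (T' t).continuous (T t).continuous (key t)
  exact DFunLike.coe_injective this

/-- A continuous functional vanishing on the range of the generator is invariant. -/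
theorem IsGenerator.functional_invariant {T : ℝ≥0 → H →L[𝕜] H} {A : H →ₗ.[𝕜] H}
    (hd : Dense (A.domain : Set H)) (hT : IsC0ContractionSemigroup T) (hAT : IsGenerator A T)
    (φ : H →L[𝕜] 𝕜) (hφ : ∀ x y, (x, y) ∈ A.graph → φ y = 0) (t : ℝ≥0) (x : H) :
    φ (T t x) = φ x := by
  have key : ∀ x ∈ A.domain, φ (T t x) = φ x := by
    intro x hx
    obtain ⟨y, hxy⟩ : ∃ y, (x, y) ∈ A.graph := ⟨_, A.mem_graph ⟨x, hx⟩⟩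
    have h := constant_of_has_deriv_right_zero (f := fun s : ℝ => φ (T s.toNNReal x)) (a := 0)
      (b := t) (φ.continuous.comp (hT.continuous_toNNReal x)).continuousOn
      (fun s hs => by
        have h1 := (φ.restrictScalars ℝ).hasFDerivAt.comp_hasDerivWithinAt s
          (hAT.hasDerivWithinAt hT hxy hs.1)
        have h2 : (φ.restrictScalars ℝ) (T s.toNNReal y) = 0 :=
          hφ _ _ (hAT.mem_graph hT hxy _)
        rw [h2] at h1
        exact h1) t (Set.right_mem_Icc.2 t.2)
    simpa [hT.zero] using h
  exact congrFun (Continuous.ext_on hd (φ.continuous.comp (T t).continuous) φ.continuous key) x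

end Semigroup

end HilleYosida

/-! ### Resolvents, Yosida approximations and exponentials of bounded operators -/

section Yosida

variable {𝕜 : Type*} [RCLike 𝕜] {H : Type*} [NormedAddCommGroup H] [InnerProductSpace 𝕜 H]

/-- Solutions of `c x - A x = z` exist by full range and are unique by `IsDissipative.mul_norm_le`;
uniqueness makes the chosen solution linear in `z`. -/
theorem exists_resolvent {A : H →ₗ.[𝕜] H} (hA : IsDissipative A) (hR : HasFullRange A) {c : ℝ}
    (hc : 0 < c) : ∃ R : H →L[𝕜] H, (∀ z, (R z, (c : 𝕜) • R z - z) ∈ A.graph) ∧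
      (∀ x y, (x, y) ∈ A.graph → R ((c : 𝕜) • x - y) = x) ∧ ∀ z, c * ‖R z‖ ≤ ‖z‖ := by
  choose r r' hr hr' using hR c hc
  have h1 : ∀ z, r' z = (c : 𝕜) • r z - z := fun z =>
    (sub_eq_of_eq_add (sub_eq_iff_eq_add'.1 (hr' z))).symm
  have huniq : ∀ x y, (x, y) ∈ A.graph → r ((c : 𝕜) • x - y) = x := by
    intro x y hxy
    set z := (c : 𝕜) • x - y with hz
    have h2 := hA.mul_norm_le c (A.graph.sub_mem (hr z) hxy)
    have h3 : (c : 𝕜) • (r z - x) - (r' z - y) = 0 := by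
      rw [smul_sub, h1, hz]; abel
    have h4 : c * ‖r z - x‖ ≤ 0 := by
      have h2' : c * ‖r z - x‖ ≤ ‖(c : 𝕜) • (r z - x) - (r' z - y)‖ := h2
      rwa [h3, norm_zero] at h2'
    have h5 : ‖r z - x‖ ≤ 0 := by
      by_contra! h
      nlinarith [mul_pos hc h]
    simpa [sub_eq_zero] using h5
  have hb : ∀ z, c * ‖r z‖ ≤ ‖z‖ := fun z => by
    have h2 := hA.mul_norm_le c (hr z)
    rwa [hr'] at h2
  let R₀ : H →ₗ[𝕜] H :=
    { toFun := r
      map_add' := fun z w => by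
        rw [← huniq _ _ (A.graph.add_mem (hr z) (hr w))]
        congr 1
        change z + w = (c : 𝕜) • (r z + r w) - (r' z + r' w)
        rw [h1, h1, smul_add]; abel
      map_smul' := fun a z => by
        rw [RingHom.id_apply, ← huniq _ _ (A.graph.smul_mem a (hr z))]
        congr 1
        change a • z = (c : 𝕜) • (a • r z) - a • r' z
        rw [h1, smul_sub, smul_comm (c : 𝕜) a]; abel }
  refine ⟨R₀.mkContinuous c⁻¹ fun z => ?_, fun z => ?_, huniq, hb⟩
  · rw [inv_mul_eq_div, le_div_iff₀ hc, mul_comm]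
    exact hb z
  · have := hr z
    rwa [h1] at this

/-- Dissipativity of a bounded operator. -/
def IsBoundedDissipative (B : H →L[𝕜] H) : Prop := ∀ x, RCLike.re (inner 𝕜 (B x) x) ≤ 0

/-- The Yosida approximation `c (c R - 1)` of an operator with resolvent `R` at `c`. -/
def yosida (R : H →L[𝕜] H) (c : ℝ) : H →L[𝕜] H :=
  (c : 𝕜) • ((c : 𝕜) • R - ContinuousLinearMap.id 𝕜 H)

theorem yosida_apply (R : H →L[𝕜] H) (c : ℝ) (x : H) :
    yosida R c x = (c : 𝕜) • ((c : 𝕜) • R x - x) := rfl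

/-- `c R` is a contraction, so `re ⟪c R x, x⟫ ≤ ‖x‖²`. -/
theorem isBoundedDissipative_yosida {R : H →L[𝕜] H} {c : ℝ} (hc : 0 < c)
    (hR : ∀ z, c * ‖R z‖ ≤ ‖z‖) : IsBoundedDissipative (yosida R c) := by
  intro x
  rw [yosida_apply, inner_smul_left, RCLike.conj_ofReal, RCLike.re_ofReal_mul, inner_sub_left,
    map_sub, inner_self_eq_norm_sq]
  have h1 : RCLike.re (inner 𝕜 ((c : 𝕜) • R x) x) ≤ ‖(c : 𝕜) • R x‖ * ‖x‖ := re_inner_le_norm _ _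
  have h2 : ‖(c : 𝕜) • R x‖ ≤ ‖x‖ := by
    rw [norm_smul, RCLike.norm_ofReal, abs_of_pos hc]; exact hR x
  have h3 := mul_le_mul_of_nonneg_right h2 (norm_nonneg x)
  exact mul_nonpos_of_nonneg_of_nonpos hc.le (by nlinarith)

/-- The one-parameter group `exp (t B)`, with real `t`. -/
def expGroup (B : H →L[𝕜] H) (t : ℝ) : H →L[𝕜] H := NormedSpace.exp ((t : 𝕜) • B)

theorem expGroup_zero (B : H →L[𝕜] H) : expGroup B 0 = ContinuousLinearMap.id 𝕜 H := by
  simp [expGroup, NormedSpace.exp_zero]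
  rfl

theorem expGroup_comm {B C : H →L[𝕜] H} (h : Commute B C) (t : ℝ) (x : H) :
    C (expGroup B t x) = expGroup B t (C x) := by
  have h1 : Commute (NormedSpace.exp ((t : 𝕜) • B)) C := (h.smul_left _).exp_left
  exact (DFunLike.congr_fun h1 x).symm

/-- The resolvent identity, obtained by applying `R` to the equation for `S` and conversely. The
commutator appears with the factor `c - e`, hence the separate case. -/
theorem commute_of_resolvents {A : H →ₗ.[𝕜] H} {R S : H →L[𝕜] H} {c e : 𝕜}
    (hR : ∀ z, (R z, c • R z - z) ∈ A.graph) (hR' : ∀ x y, (x, y) ∈ A.graph → R (c • x - y) = x)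
    (hS : ∀ z, (S z, e • S z - z) ∈ A.graph) (hS' : ∀ x y, (x, y) ∈ A.graph → S (e • x - y) = x) :
    c = e ∨ Commute R S := by
  by_cases hce : c = e
  · exact Or.inl hce
  refine Or.inr (ContinuousLinearMap.ext fun z => ?_)
  change R (S z) = S (R z)
  have h1 := hR' _ _ (hS z)
  have h2 := hS' _ _ (hR z)
  simp only [map_sub, map_smul] at h1 h2
  have h3 : (c - e) • (R (S z) - S (R z)) = 0 := by
    have : (c - e) • (R (S z) - S (R z)) =
      (c • R (S z) - (e • R (S z) - R z)) + (e • S (R z) - (c • S (R z) - S z))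
        - R z - S z := by module
    rw [this, h1, h2]; abel
  rcases smul_eq_zero.1 h3 with h | h
  · exact absurd (sub_eq_zero.1 h) hce
  · exact sub_eq_zero.1 h

theorem expGroup_add [CompleteSpace H] (B : H →L[𝕜] H) (s t : ℝ) :
    expGroup B (s + t) = (expGroup B s).comp (expGroup B t) := by
  let _ : NormedAlgebra ℚ (H →L[𝕜] H) := NormedAlgebra.restrictScalars ℚ 𝕜 _
  rw [expGroup, RCLike.ofReal_add, add_smul, NormedSpace.exp_add_of_commute]
  · rfl
  · exact ((Commute.refl B).smul_left _).smul_right _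

variable [NormedSpace ℝ H] [IsScalarTower ℝ 𝕜 H]

theorem hasDerivAt_comp_ofReal {f : 𝕜 → H} {f' : H} {t : ℝ} (hf : HasDerivAt f f' (t : 𝕜)) :
    HasDerivAt (fun s : ℝ => f (s : 𝕜)) f' t := by
  have h := (hf.hasFDerivAt.restrictScalars ℝ).comp_hasDerivAt t
    ((RCLike.ofRealCLM (K := 𝕜)).hasDerivAt (x := t))
  simpa [Function.comp_def] using h

variable [CompleteSpace H]

theorem hasDerivAt_expGroup_apply (B : H →L[𝕜] H) (x : H) (t : ℝ) :
    HasDerivAt (fun s : ℝ => expGroup B s x) (expGroup B t (B x)) t := by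
  refine hasDerivAt_comp_ofReal (f := fun u : 𝕜 => NormedSpace.exp (u • B) x) ?_
  have h := (hasDerivAt_exp_smul_const B (t : 𝕜)).clm_apply (hasDerivAt_const _ x)
  rw [map_zero, add_zero] at h
  exact h

theorem norm_expGroup_apply_le {B : H →L[𝕜] H} (hB : IsBoundedDissipative B) {t : ℝ} (ht : 0 ≤ t)
    (x : H) : ‖expGroup B t x‖ ≤ ‖x‖ := by
  have h := norm_le_of_hasDerivWithinAt_of_re_inner_nonpos (𝕜 := 𝕜)
    (u := fun s => expGroup B s x) (u' := fun s => expGroup B s (B x)) ht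
    (fun s _ => (hasDerivAt_expGroup_apply B x s).continuousAt.continuousWithinAt)
    (fun s _ => (hasDerivAt_expGroup_apply B x s).hasDerivWithinAt)
    (fun s _ => by rw [← expGroup_comm (Commute.refl B)]; exact hB _)
  simpa [expGroup_zero] using h

/-- Interpolate by `s ↦ exp (s B) exp ((t - s) C) x`. Its derivative is `exp (s B) exp ((t - s) C)
(B x - C x)`, and both exponentials are contractions for `0 ≤ s ≤ t`. Commutation is what lets `B`
pass through `exp ((t - s) C)`. -/
theorem norm_expGroup_sub_le {B C : H →L[𝕜] H} (hB : IsBoundedDissipative B)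
    (hC : IsBoundedDissipative C) (hBC : Commute B C) {t : ℝ} (ht : 0 ≤ t) (x : H) :
    ‖expGroup B t x - expGroup C t x‖ ≤ ‖B x - C x‖ * t := by
  have hd : ∀ s : ℝ, HasDerivAt (fun s : ℝ => expGroup B s (expGroup C (t - s) x))
      (expGroup B s (expGroup C (t - s) (B x - C x))) s := by
    intro s
    have h1 : HasDerivAt (fun u : 𝕜 => NormedSpace.exp (((t : 𝕜) - u) • C) x)
        (-(NormedSpace.exp (((t : 𝕜) - (s : 𝕜)) • C) (C x))) (s : 𝕜) := by
      have h2 := (hasDerivAt_exp_smul_const C ((t : 𝕜) - (s : 𝕜))).scomp (s : 𝕜)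
        ((hasDerivAt_id (s : 𝕜)).const_sub (t : 𝕜))
      have h5 := h2.clm_apply (hasDerivAt_const _ x)
      rw [map_zero, add_zero, neg_one_smul] at h5
      exact h5
    have h3 := hasDerivAt_comp_ofReal
      ((hasDerivAt_exp_smul_const B (s : 𝕜)).clm_apply h1)
    have h4 : B (expGroup C (t - s) x) = expGroup C (t - s) (B x) := expGroup_comm hBC.symm _ _
    simp only [expGroup, RCLike.ofReal_sub] at h4 ⊢
    convert h3 using 1
    simp only [map_neg, map_sub]
    change _ = (NormedSpace.exp ((s : 𝕜) • B)) (B _) + _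
    rw [h4, sub_eq_add_neg]
  have h := norm_image_sub_le_of_norm_deriv_le_segment' (C := ‖B x - C x‖)
    (fun s _ => (hd s).hasDerivWithinAt) (fun s hs => (norm_expGroup_apply_le hB hs.1 _).trans
      (norm_expGroup_apply_le hC (sub_nonneg.2 hs.2.le) _)) t (Set.right_mem_Icc.2 ht)
  simpa [expGroup_zero] using h

end Yosida

/-! ### Generation of contraction semigroups -/

section Generation

variable {𝕜 : Type*} [RCLike 𝕜] {H : Type*} [NormedAddCommGroup H] [InnerProductSpace 𝕜 H]

theorem tendsto_of_dense_of_norm_le {α : Type*} {l : Filter α} {F : α → H →L[𝕜] H} {G : H →L[𝕜] H}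
    (hF : ∀ a x, ‖F a x‖ ≤ ‖x‖) (hG : ∀ x, ‖G x‖ ≤ ‖x‖) {D : Set H} (hD : Dense D)
    (h : ∀ x ∈ D, Tendsto (fun a => F a x) l (𝓝 (G x))) (x : H) :
    Tendsto (fun a => F a x) l (𝓝 (G x)) := by
  rw [Metric.tendsto_nhds]
  intro ε hε
  obtain ⟨d, hd, hxd⟩ := Metric.dense_iff.1 hD x (ε / 3) (by positivity)
  filter_upwards [(Metric.tendsto_nhds.1 (h d hxd)) (ε / 3) (by positivity)] with a ha
  have h1 : ‖d - x‖ < ε / 3 := by simpa [dist_eq_norm] using hd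
  rw [dist_eq_norm] at ha ⊢
  have h2 : F a x - G x = (F a d - G d) - F a (d - x) + G (d - x) := by
    simp only [map_sub]; abel
  rw [h2]
  calc _ ≤ ‖F a d - G d‖ + ‖F a (d - x)‖ + ‖G (d - x)‖ :=
        (norm_add_le _ _).trans (by gcongr; exact norm_sub_le _ _)
    _ < ε := by linarith [hF a (d - x), hG (d - x)]

theorem cauchySeq_of_dense_of_norm_le {F : ℕ → H →L[𝕜] H}
    (hF : ∀ n x, ‖F n x‖ ≤ ‖x‖) {D : Set H} (hD : Dense D)
    (h : ∀ x ∈ D, CauchySeq fun n => F n x) (x : H) : CauchySeq fun n => F n x := by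
  rw [Metric.cauchySeq_iff]
  intro ε hε
  obtain ⟨d, hd, hxd⟩ := Metric.dense_iff.1 hD x (ε / 3) (by positivity)
  obtain ⟨N, hN⟩ := Metric.cauchySeq_iff.1 (h d hxd) (ε / 3) (by positivity)
  refine ⟨N, fun m hm n hn => ?_⟩
  have ha := hN m hm n hn
  have h1 : ‖d - x‖ < ε / 3 := by simpa [dist_eq_norm] using hd
  rw [dist_eq_norm] at ha ⊢
  have h2 : F m x - F n x = (F m d - F n d) - F m (d - x) + F n (d - x) := by
    simp only [map_sub]; abel
  rw [h2]
  calc _ ≤ ‖F m d - F n d‖ + ‖F m (d - x)‖ + ‖F n (d - x)‖ :=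
        (norm_add_le _ _).trans (by gcongr; exact norm_sub_le _ _)
    _ < ε := by linarith [hF m (d - x), hF n (d - x)]

theorem tendsto_apply_of_norm_le {α : Type*} {l : Filter α} {F : α → H →L[𝕜] H} {G : H →L[𝕜] H}
    (hF : ∀ a x, ‖F a x‖ ≤ ‖x‖) (h : ∀ x, Tendsto (fun a => F a x) l (𝓝 (G x)))
    {u : α → H} {x : H} (hu : Tendsto u l (𝓝 x)) : Tendsto (fun a => F a (u a)) l (𝓝 (G x)) := by
  have h1 : Tendsto (fun a => F a (u a - x)) l (𝓝 0) :=
    squeeze_zero_norm (fun a => hF a _) (by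
      simpa using (tendsto_iff_norm_sub_tendsto_zero.1 hu))
  simpa using h1.add (h x)

theorem exists_clm_of_cauchySeq [CompleteSpace H] {F : ℕ → H →L[𝕜] H} (hF : ∀ n x, ‖F n x‖ ≤ ‖x‖)
    (h : ∀ x, CauchySeq fun n => F n x) :
    ∃ G : H →L[𝕜] H, (∀ x, Tendsto (fun n => F n x) atTop (𝓝 (G x))) ∧ ∀ x, ‖G x‖ ≤ ‖x‖ := by
  choose g hg using fun x => cauchySeq_tendsto_of_complete (h x)
  have hb : ∀ x, ‖g x‖ ≤ ‖x‖ := fun x =>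
    le_of_tendsto (hg x).norm (Eventually.of_forall fun n => hF n x)
  exact ⟨(linearMapOfTendsto g (fun n => (F n).toLinearMap) (tendsto_pi_nhds.2 hg)).mkContinuous 1
    fun x => by simpa using hb x, hg, hb⟩

/-- On the domain, `c R x - x = R (A x)` has norm at most `‖A x‖ / c`. The operators `c R` are
contractions, so convergence extends by density. -/
theorem tendsto_smul_resolvent {A : H →ₗ.[𝕜] H} (hd : Dense (A.domain : Set H))
    {R : ℕ → H →L[𝕜] H} {c : ℕ → ℝ} (hc : ∀ n, 0 < c n) (hc' : Tendsto c atTop atTop)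
    (hR : ∀ n x y, (x, y) ∈ A.graph → R n ((c n : 𝕜) • x - y) = x)
    (hb : ∀ n z, c n * ‖R n z‖ ≤ ‖z‖) (x : H) :
    Tendsto (fun n => (c n : 𝕜) • R n x) atTop (𝓝 x) := by
  refine tendsto_of_dense_of_norm_le (F := fun n => (c n : 𝕜) • R n)
    (G := ContinuousLinearMap.id 𝕜 H) (fun n z => ?_) (fun z => le_rfl) hd (fun z hz => ?_) x
  · rw [smul_apply, norm_smul, RCLike.norm_ofReal, abs_of_pos (hc n)]
    exact hb n z
  · obtain ⟨w, hw⟩ : ∃ w, (z, w) ∈ A.graph := ⟨_, A.mem_graph ⟨z, hz⟩⟩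
    rw [tendsto_iff_norm_sub_tendsto_zero]
    have h1 : Tendsto (fun n => ‖w‖ / c n) atTop (𝓝 0) := tendsto_const_nhds.div_atTop hc'
    refine squeeze_zero (fun _ => norm_nonneg _) (fun n => ?_) h1
    have h2 := hR n z w hw
    rw [map_sub, map_smul] at h2
    have h3 : (c n : 𝕜) • R n z - z = R n w := by
      nth_rewrite 2 [← h2]; abel
    rw [smul_apply, ContinuousLinearMap.id_apply, h3, le_div_iff₀ (hc n), mul_comm]
    exact hb n w

theorem expGroup_zero_left (t : ℝ) : expGroup (0 : H →L[𝕜] H) t = ContinuousLinearMap.id 𝕜 H := by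
  rw [expGroup, smul_zero, NormedSpace.exp_zero]
  rfl

/-- The generator of `T` extends `A` and is dissipative because `T` contracts; as `1 - A` is already
onto, the extension cannot be proper. -/
theorem isGenerator_of_hasFullRange {A : H →ₗ.[𝕜] H}
    (hR : HasFullRange A) {T : ℝ≥0 → H →L[𝕜] H} (hT : ∀ t x, ‖T t x‖ ≤ ‖x‖)
    (h : ∀ x y, (x, y) ∈ A.graph →
      Tendsto (fun t : ℝ≥0 => (((t : ℝ)⁻¹ : ℝ) : 𝕜) • (T t x - x)) (𝓝[>] 0) (𝓝 y)) :
    IsGenerator A T := by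
  refine fun x y => ⟨h x y, fun hxy => ?_⟩
  obtain ⟨v, w, hvw, hv⟩ := hR 1 one_pos (x - y)
  rw [RCLike.ofReal_one, one_smul] at hv
  -- The difference quotients of `x - v` tend to `y - w`, which equals `x - v` by the choice of `v`.
  -- Contractivity makes the limit inner product nonpositive, so `‖x - v‖² ≤ 0`.
  have h1 := (hxy.sub (h v w hvw)).inner (tendsto_const_nhds (x := x - v)) (𝕜 := 𝕜)
  have h2 : RCLike.re (inner 𝕜 (y - w) (x - v)) ≤ 0 := by
    refine le_of_tendsto ((RCLike.continuous_re.tendsto _).comp h1) (Eventually.of_forall fun t => ?_)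
    have h3 : (((t : ℝ)⁻¹ : ℝ) : 𝕜) • (T t x - x) - (((t : ℝ)⁻¹ : ℝ) : 𝕜) • (T t v - v)
        = (((t : ℝ)⁻¹ : ℝ) : 𝕜) • (T t (x - v) - (x - v)) := by
      rw [map_sub]; module
    simp only [Function.comp_apply]
    rw [h3, inner_smul_left, RCLike.conj_ofReal, RCLike.re_ofReal_mul, inner_sub_left, map_sub,
      inner_self_eq_norm_sq]
    have h4 : RCLike.re (inner 𝕜 (T t (x - v)) (x - v)) ≤ ‖T t (x - v)‖ * ‖x - v‖ :=
      re_inner_le_norm _ _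
    have h5 := mul_le_mul_of_nonneg_right (hT t (x - v)) (norm_nonneg (x - v))
    exact mul_nonpos_of_nonneg_of_nonpos (by positivity) (by nlinarith)
  have h6 : y - w = x - v := by
    rw [sub_eq_sub_iff_add_eq_add] at hv ⊢
    rw [add_comm y v, hv, add_comm]
  rw [h6, inner_self_eq_norm_sq] at h2
  have h7 : x - v = 0 := by
    rw [← norm_eq_zero]
    exact pow_eq_zero_iff (two_ne_zero) |>.1 (le_antisymm h2 (sq_nonneg _))
  rw [h7] at h6
  rw [sub_eq_zero.1 h7, sub_eq_zero.1 h6]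
  exact hvw

variable [NormedSpace ℝ H] [IsScalarTower ℝ 𝕜 H] [CompleteSpace H]

/-- A densely defined dissipative operator `A` with `c - A` onto for all `c > 0` generates a
contraction semigroup. -/
theorem exists_contractionSemigroup {A : H →ₗ.[𝕜] H} (hd : Dense (A.domain : Set H))
    (hA : IsDissipative A) (hR : HasFullRange A) :
    ∃ T : ℝ≥0 → H →L[𝕜] H, IsC0ContractionSemigroup T ∧ IsGenerator A T := by
  let c : ℕ → ℝ := fun n => n + 1
  have hc : ∀ n, 0 < c n := fun n => by positivity
  have hc' : Tendsto c atTop atTop :=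
    tendsto_atTop_add_const_right _ _ tendsto_natCast_atTop_atTop
  choose R hR1 hR2 hR3 using fun n => exists_resolvent hA hR (hc n)
  let B : ℕ → H →L[𝕜] H := fun n => yosida (R n) (c n)
  have hB : ∀ n, IsBoundedDissipative (B n) := fun n =>
    isBoundedDissipative_yosida (hc n) (hR3 n)
  have hcomm : ∀ n m, Commute (B n) (B m) := by
    intro n m
    rcases commute_of_resolvents (hR1 n) (hR2 n) (hR1 m) (hR2 m) with h | h
    · have : n = m := by
        have h' : c n = c m := by exact_mod_cast h
        simpa [c] using h'
      rw [this]
    · have h1 : ∀ S : H →L[𝕜] H, Commute S (ContinuousLinearMap.id 𝕜 H) := Commute.one_right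
      have h2 : Commute ((c n : 𝕜) • R n - ContinuousLinearMap.id 𝕜 H)
          ((c m : 𝕜) • R m - ContinuousLinearMap.id 𝕜 H) :=
        (((h.smul_left _).smul_right _).sub_right (h1 _)).sub_left (h1 _).symm
      exact (h2.smul_left _).smul_right _
  -- On the domain `B n x = c R (A x)`, and `c R → 1` strongly.
  have hBlim : ∀ x y, (x, y) ∈ A.graph → Tendsto (fun n => B n x) atTop (𝓝 y) := by
    intro x y hxy
    refine (tendsto_smul_resolvent hd hc hc' hR2 hR3 y).congr fun n => ?_
    have h2 := hR2 n x y hxy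
    rw [map_sub, map_smul] at h2
    rw [yosida_apply]
    congr 1
    nth_rewrite 2 [← h2]; abel
  have hS : ∀ n (t : ℝ≥0) x, ‖expGroup (B n) t x‖ ≤ ‖x‖ := fun n t x =>
    norm_expGroup_apply_le (hB n) t.2 x
  have hcau : ∀ (t : ℝ≥0) x, CauchySeq fun n => expGroup (B n) t x := by
    intro t
    refine cauchySeq_of_dense_of_norm_le (fun n => hS n t) hd fun x hx => ?_
    obtain ⟨y, hxy⟩ : ∃ y, (x, y) ∈ A.graph := ⟨_, A.mem_graph ⟨x, hx⟩⟩
    have h1 : CauchySeq fun n => B n x := (hBlim x y hxy).cauchySeq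
    rw [Metric.cauchySeq_iff] at h1 ⊢
    intro ε hε
    obtain ⟨N, hN⟩ := h1 (ε / (t + 1)) (by positivity)
    refine ⟨N, fun m hm n hn => ?_⟩
    have h2 := hN m hm n hn
    rw [dist_eq_norm] at h2 ⊢
    have h3 : (0 : ℝ) < t + 1 := by positivity
    rw [lt_div_iff₀ h3] at h2
    have h4 := norm_expGroup_sub_le (hB m) (hB n) (hcomm m n) t.2 x
    have h5 := norm_nonneg (B m x - B n x)
    refine h4.trans_lt (lt_of_le_of_lt ?_ h2)
    exact mul_le_mul_of_nonneg_left (by simp) h5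
  choose T hT1 hT2 using fun t : ℝ≥0 => exists_clm_of_cauchySeq (fun n => hS n t) (hcau t)
  have hT0 : T 0 = ContinuousLinearMap.id 𝕜 H := by
    ext x
    refine tendsto_nhds_unique (hT1 0 x) ?_
    simp [expGroup_zero]
  have hTadd : ∀ s t, T (s + t) = (T s).comp (T t) := by
    intro s t
    ext x
    refine tendsto_nhds_unique (hT1 (s + t) x) ?_
    have h1 := tendsto_apply_of_norm_le (fun n => hS n s) (hT1 s) (hT1 t x)
    refine h1.congr fun n => ?_
    rw [NNReal.coe_add, expGroup_add]
    rfl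
  have hlip : ∀ x y, (x, y) ∈ A.graph → ∀ t : ℝ≥0, ‖T t x - x‖ ≤ ‖y‖ * t := by
    intro x y hxy t
    refine le_of_tendsto_of_tendsto ((hT1 t x).sub_const x).norm
      ((hBlim x y hxy).norm.mul_const (t : ℝ)) (Eventually.of_forall fun n => ?_)
    -- Comparison with the zero operator, whose exponential is the identity.
    have h := norm_expGroup_sub_le (hB n) (C := 0) (fun z => by simp) (Commute.zero_right _) t.2 x
    simpa [expGroup_zero_left] using h
  have hcontD : ∀ x y, (x, y) ∈ A.graph → Continuous fun t => T t x := by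
    intro x y hxy
    have h1 : ∀ s t : ℝ≥0, s ≤ t → dist (T s x) (T t x) ≤ ‖y‖ * dist s t := by
      intro s t hst
      obtain ⟨r, rfl⟩ := exists_add_of_le hst
      rw [dist_comm, dist_eq_norm, hTadd, ContinuousLinearMap.comp_apply, ← map_sub]
      refine (hT2 s _).trans ((hlip x y hxy r).trans (le_of_eq ?_))
      rw [NNReal.dist_eq]
      simp
    refine (LipschitzWith.of_dist_le_mul (K := ‖y‖₊) fun s t => ?_).continuous
    rcases le_total s t with h | h
    · exact h1 s t h
    · rw [dist_comm, dist_comm s t]; exact h1 t s h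
  have hcont : ∀ x, Continuous fun t => T t x := by
    intro x
    refine continuous_iff_continuousAt.2 fun t => ?_
    refine tendsto_of_dense_of_norm_le (F := T) hT2 (hT2 t) hd (fun z hz => ?_) x
    exact (hcontD z _ (A.mem_graph ⟨z, hz⟩)).tendsto t
  have hint : ∀ x y, (x, y) ∈ A.graph → ∀ t : ℝ≥0,
      T t x - x = ∫ s in (0 : ℝ)..t, T s.toNNReal y := by
    intro x y hxy t
    refine tendsto_nhds_unique ((hT1 t x).sub_const x) ?_
    -- The integral formula holds for `exp (s B n)`; dominated convergence, with bound `sup ‖B n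
    -- x‖`, carries it to the limit.
    have h1 : ∀ n, ∫ s in (0 : ℝ)..t, expGroup (B n) s (B n x) = expGroup (B n) t x - x := by
      intro n
      rw [intervalIntegral.integral_eq_sub_of_hasDerivAt
        (fun s _ => hasDerivAt_expGroup_apply (B n) x s), expGroup_zero]
      · rfl
      · refine Continuous.intervalIntegrable ?_ _ _
        exact continuous_iff_continuousAt.2 fun s =>
          (hasDerivAt_expGroup_apply (B n) (B n x) s).continuousAt
    simp only [← h1]
    obtain ⟨C, hC⟩ := (hBlim x y hxy).norm.bddAbove_range
    refine intervalIntegral.tendsto_integral_filter_of_dominated_convergence (fun _ => C)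
      (Eventually.of_forall fun n => ?_) (Eventually.of_forall fun n => ae_of_all _ fun s hs => ?_)
      intervalIntegrable_const (ae_of_all _ fun s hs => ?_)
    · refine Continuous.aestronglyMeasurable ?_
      exact continuous_iff_continuousAt.2 fun s =>
          (hasDerivAt_expGroup_apply (B n) (B n x) s).continuousAt
    · rw [Set.uIoc_of_le t.coe_nonneg] at hs
      exact (norm_expGroup_apply_le (hB n) hs.1.le _).trans (hC ⟨n, rfl⟩)
    · rw [Set.uIoc_of_le t.coe_nonneg] at hs
      have h2 := tendsto_apply_of_norm_le (fun n => hS n s.toNNReal) (hT1 s.toNNReal)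
        (hBlim x y hxy)
      rwa [Real.coe_toNNReal _ hs.1.le] at h2
  refine ⟨T, ⟨hT0, hTadd, hcont, fun t => ?_⟩, isGenerator_of_hasFullRange hR hT2 fun x y hxy => ?_⟩
  · exact ContinuousLinearMap.opNorm_le_bound _ zero_le_one fun x => by simpa using hT2 t x
  · have h1 : Continuous fun s : ℝ => T s.toNNReal y := (hcont y).comp continuous_real_toNNReal
    -- The integrand is continuous with value `y` at `0`, so the integral formula gives the
    -- derivative of the orbit at `0`.
    have h2 := intervalIntegral.integral_hasDerivAt_right (h1.intervalIntegrable 0 0)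
      h1.stronglyMeasurable.stronglyMeasurableAtFilter h1.continuousAt
    rw [hasDerivAt_iff_tendsto_slope, Real.toNNReal_zero, hT0] at h2
    have h3 : Tendsto (fun t : ℝ≥0 => (t : ℝ)) (𝓝[>] 0) (𝓝[≠] 0) := by
      refine tendsto_nhdsWithin_iff.2 ⟨?_, ?_⟩
      · exact (NNReal.continuous_coe.tendsto 0).mono_left nhdsWithin_le_nhds
      · filter_upwards [self_mem_nhdsWithin] with t ht
        simpa using (ne_of_gt ht)
    refine (h2.comp h3).congr fun t => ?_
    rw [Function.comp_apply, slope_def_module, hint x y hxy, intervalIntegral.integral_same,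
      sub_zero, sub_zero, RCLike.real_smul_eq_coe_smul (K := 𝕜)]

end Generation

/-! ### Closures, adjoints and a criterion for self-adjointness -/

section SelfAdjoint

variable {𝕜 : Type*} [RCLike 𝕜] {H : Type*} [NormedAddCommGroup H] [InnerProductSpace 𝕜 H]

/-- The graph of the closure is the closure of the graph, so any closed relation passes to it. -/
theorem mem_graph_closure_induction {A : H →ₗ.[𝕜] H} (hc : A.IsClosable) {P : H → H → Prop}
    (hP : IsClosed {p : H × H | P p.1 p.2}) (h : ∀ x y, (x, y) ∈ A.graph → P x y) {x y : H}
    (hxy : (x, y) ∈ A.closure.graph) : P x y := by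
  rw [← hc.graph_closure_eq_closure_graph] at hxy
  exact closure_minimal (fun p hp => h p.1 p.2 hp) hP hxy

theorem mem_graph_closure {A : H →ₗ.[𝕜] H} {x y : H} (hxy : (x, y) ∈ A.graph) :
    (x, y) ∈ A.closure.graph := LinearPMap.le_graph_iff.2 A.le_closure hxy

/-- Symmetry of an operator, in terms of its graph. -/
def IsGraphSymmetric (A : H →ₗ.[𝕜] H) : Prop :=
  ∀ x y a b, (x, y) ∈ A.graph → (a, b) ∈ A.graph → inner 𝕜 b x = inner 𝕜 a y

theorem IsDissipative.closure {A : H →ₗ.[𝕜] H} (hA : IsDissipative A) (hc : A.IsClosable) :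
    IsDissipative A.closure := fun x y hxy => by
  refine mem_graph_closure_induction hc (P := fun x y => RCLike.re (inner 𝕜 y x) ≤ 0) ?_ hA hxy
  exact isClosed_le (RCLike.continuous_re.comp (continuous_snd.inner continuous_fst))
    continuous_const

theorem IsGraphSymmetric.closure {A : H →ₗ.[𝕜] H} (hs : IsGraphSymmetric A) (hc : A.IsClosable) :
    IsGraphSymmetric A.closure := by
  intro x y a b hxy hab
  refine mem_graph_closure_induction hc (P := fun x y => inner 𝕜 b x = inner 𝕜 a y) ?_ ?_ hxy
  · exact isClosed_eq (continuous_const.inner continuous_fst)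
      (continuous_const.inner continuous_snd)
  intro x y hxy
  refine mem_graph_closure_induction hc (P := fun a b => inner 𝕜 b x = inner 𝕜 a y) ?_ ?_ hab
  · exact isClosed_eq (continuous_snd.inner continuous_const)
      (continuous_fst.inner continuous_const)
  exact fun a b hab => hs x y a b hxy hab

variable [CompleteSpace H]

theorem mem_graph_adjoint_iff {A : H →ₗ.[𝕜] H} (hd : Dense (A.domain : Set H)) {x y : H} :
    (x, y) ∈ A.adjoint.graph ↔ ∀ a b, (a, b) ∈ A.graph → inner 𝕜 b x = inner 𝕜 a y := by
  rw [LinearPMap.adjoint_graph_eq_graph_adjoint hd, Submodule.mem_adjoint_iff]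
  simp only [sub_eq_zero]

theorem IsGraphSymmetric.isSymmetricOp {A : H →ₗ.[𝕜] H} (hs : IsGraphSymmetric A)
    (hd : Dense (A.domain : Set H)) : IsSymmetricOp A := by
  refine ⟨hd, LinearPMap.le_graph_iff.1 ?_⟩
  rintro ⟨x, y⟩ hxy
  exact (mem_graph_adjoint_iff hd).2 fun a b hab => hs x y a b hxy hab

theorem IsGraphSymmetric.isClosable {A : H →ₗ.[𝕜] H} (hs : IsGraphSymmetric A)
    (hd : Dense (A.domain : Set H)) : A.IsClosable :=
  (A.adjoint_isClosed hd).isClosable.leIsClosable (hs.isSymmetricOp hd).2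

/-- The range of `c - A` has trivial orthogonal complement for all `c > 0`. -/
def HasDenseRange (A : H →ₗ.[𝕜] H) : Prop :=
  ∀ c : ℝ, 0 < c → ∀ z : H, (∀ x y, (x, y) ∈ A.graph → inner 𝕜 z ((c : 𝕜) • x - y) = 0) → z = 0

/-- On the complete space `A.closure.graph`, the map `(x, y) ↦ c x - y` is bounded below, so its
range is closed; its orthogonal complement is trivial by hypothesis. -/
theorem HasDenseRange.hasFullRange_closure {A : H →ₗ.[𝕜] H} (hr : HasDenseRange A)
    (hA : IsDissipative A) (hc : A.IsClosable) : HasFullRange A.closure := by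
  intro c hc0 z
  let Φ : A.closure.graph →L[𝕜] H :=
    ((c : 𝕜) • ContinuousLinearMap.fst 𝕜 H H - ContinuousLinearMap.snd 𝕜 H H).comp
      A.closure.graph.subtypeL
  have hΦ : ∀ p, Φ p = (c : 𝕜) • p.1.1 - p.1.2 := fun p => rfl
  -- With `Φ = c x - y`: `‖x‖ ≤ c⁻¹ ‖Φ‖` and `‖y‖ ≤ c ‖x‖ + ‖Φ‖ ≤ 2 ‖Φ‖`, and the sum of the two
  -- constants bounds the maximum.
  have hanti : AntilipschitzWith (Real.toNNReal (c⁻¹ + 2)) Φ := by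
    refine ContinuousLinearMap.antilipschitz_of_bound Φ fun p => ?_
    have h1 := (hA.closure hc).mul_norm_le c (x := p.1.1) (y := p.1.2) p.2
    rw [← hΦ] at h1
    have h2 : ‖p.1.1‖ ≤ c⁻¹ * ‖Φ p‖ := by
      rw [inv_mul_eq_div, le_div_iff₀ hc0, mul_comm]; exact h1
    have h3 : ‖p.1.2‖ ≤ c * ‖p.1.1‖ + ‖Φ p‖ := by
      have h4 : p.1.2 = (c : 𝕜) • p.1.1 - Φ p := by rw [hΦ]; abel
      have h5 := norm_sub_le ((c : 𝕜) • p.1.1) (Φ p)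
      rwa [← h4, norm_smul, RCLike.norm_ofReal, abs_of_pos hc0] at h5
    have h6 := norm_nonneg (Φ p)
    have h7 : 0 ≤ c⁻¹ := by positivity
    rw [Real.coe_toNNReal _ (by positivity)]
    change max ‖p.1.1‖ ‖p.1.2‖ ≤ _
    refine max_le ?_ ?_ <;> nlinarith [mul_nonneg h7 h6]
  have hclosed : IsClosed (A.closure.graph : Set (H × H)) := hc.closure_isClosed
  have : CompleteSpace A.closure.graph := hclosed.completeSpace_coe
  have hrange : IsClosed (LinearMap.range (Φ : A.closure.graph →ₗ[𝕜] H) : Set H) := by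
    rw [LinearMap.coe_range]
    exact hanti.isClosed_range Φ.uniformContinuous
  have : CompleteSpace (LinearMap.range (Φ : A.closure.graph →ₗ[𝕜] H)) :=
    hrange.completeSpace_coe
  have htop : LinearMap.range (Φ : A.closure.graph →ₗ[𝕜] H) = ⊤ := by
    rw [← Submodule.orthogonal_eq_bot_iff, Submodule.eq_bot_iff]
    intro w hw
    refine hr c hc0 w fun x y hxy => ?_
    rw [Submodule.mem_orthogonal'] at hw
    exact hw _ ⟨⟨(x, y), mem_graph_closure hxy⟩, rfl⟩
  obtain ⟨p, hp⟩ : z ∈ LinearMap.range (Φ : A.closure.graph →ₗ[𝕜] H) := htop ▸ Submodule.mem_top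
  exact ⟨p.1.1, p.1.2, p.2, hp⟩

/-- Given `(u, w)` in the graph of the adjoint, solve `v - A v = u - w`. Then the adjoint fixes `u -
v`, so `u - v` is orthogonal to the range of `1 - A`, which is everything. -/
theorem IsGraphSymmetric.isSelfAdjoint_of_hasFullRange {A : H →ₗ.[𝕜] H} (hs : IsGraphSymmetric A)
    (hd : Dense (A.domain : Set H)) (hR : HasFullRange A) : IsSelfAdjoint A := by
  rw [LinearPMap.isSelfAdjoint_def]
  refine le_antisymm (LinearPMap.le_graph_iff.1 ?_) (hs.isSymmetricOp hd).2
  rintro ⟨u, w⟩ huw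
  obtain ⟨v, z, hvz, hv⟩ := hR 1 one_pos (u - w)
  rw [RCLike.ofReal_one, one_smul] at hv
  rw [mem_graph_adjoint_iff hd] at huw
  have he : w - z = u - v := by
    rw [sub_eq_sub_iff_add_eq_add] at hv ⊢
    rw [add_comm w v, hv]
  have h0 : u - v = 0 := by
    obtain ⟨a, b, hab, h⟩ := hR 1 one_pos (u - v)
    rw [RCLike.ofReal_one, one_smul] at h
    have h1 : inner 𝕜 (a - b) (u - v) = 0 := by
      rw [inner_sub_left]
      nth_rewrite 1 [← he]
      rw [inner_sub_right, inner_sub_right, huw a b hab, hs v z a b hvz hab, sub_self]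
    rw [h] at h1
    exact inner_self_eq_zero.1 h1
  rw [h0] at he
  rw [sub_eq_zero.1 h0, sub_eq_zero.1 he]
  exact hvz

end SelfAdjoint

/-! ### Product rules and conjugation on Schwartz functions -/

section SchwartzCalculus

variable {𝕜 : Type*} [RCLike 𝕜] {d : ℕ}

theorem hasTemperateGrowth_ofReal_clm (l : Rd d →L[ℝ] ℝ) :
    Function.HasTemperateGrowth fun x : Rd d => ((l x : ℝ) : 𝕜) :=
  ((RCLike.ofRealCLM (K := 𝕜)).comp l).hasTemperateGrowth

/-- Multiplication by the `i`-th coordinate. -/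
def coordMul (i : Fin d) : 𝓢(Rd d, 𝕜) →L[𝕜] 𝓢(Rd d, 𝕜) :=
  SchwartzMap.smulLeftCLM 𝕜 (fun x : Rd d => ((x i : ℝ) : 𝕜))

theorem coordMul_apply (i : Fin d) (f : 𝓢(Rd d, 𝕜)) (x : Rd d) :
    coordMul i f x = ((x i : ℝ) : 𝕜) * f x :=
  SchwartzMap.smulLeftCLM_apply_apply
    (hasTemperateGrowth_ofReal_clm (EuclideanSpace.proj i : Rd d →L[ℝ] ℝ)) f x

theorem lineDerivOp_smulLeftCLM {p p' : Rd d → 𝕜} (hp : p.HasTemperateGrowth)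
    (hp' : p'.HasTemperateGrowth) {v : Rd d} (h : ∀ x, fderiv ℝ p x v = p' x) (f : 𝓢(Rd d, 𝕜)) :
    ∂_{v} (SchwartzMap.smulLeftCLM 𝕜 p f) =
      SchwartzMap.smulLeftCLM 𝕜 p' f + SchwartzMap.smulLeftCLM 𝕜 p (∂_{v} f) := by
  ext x
  have hpd : DifferentiableAt ℝ p x := (hp.1.differentiable (by simp)) x
  rw [_root_.add_apply, SchwartzMap.lineDerivOp_apply_eq_fderiv,
    SchwartzMap.smulLeftCLM_apply hp, SchwartzMap.smulLeftCLM_apply_apply hp',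
    SchwartzMap.smulLeftCLM_apply_apply hp, SchwartzMap.lineDerivOp_apply_eq_fderiv, ← h x]
  have := fderiv_mul hpd (f.differentiableAt (x := x))
  simp only [smul_eq_mul]
  change fderiv ℝ (p * ⇑f) x v = _
  rw [this]
  simp
  ring

theorem lineDerivOp_coordMul (i : Fin d) (f : 𝓢(Rd d, 𝕜)) :
    ∂_{basisVec i} (coordMul i f) = f + coordMul i (∂_{basisVec i} f) := by
  have h1 : ((RCLike.ofRealCLM (K := 𝕜)).comp
    (EuclideanSpace.proj i : Rd d →L[ℝ] ℝ) (basisVec i)) = 1 := by simp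
  have h := lineDerivOp_smulLeftCLM (𝕜 := 𝕜) (p' := fun _ => 1) (v := basisVec i)
    (hasTemperateGrowth_ofReal_clm (EuclideanSpace.proj i : Rd d →L[ℝ] ℝ))
    (Function.HasTemperateGrowth.const 1) (fun x => by
      rw [← h1]
      exact congrFun (congrArg _ (((RCLike.ofRealCLM (K := 𝕜)).comp
        (EuclideanSpace.proj i : Rd d →L[ℝ] ℝ)).fderiv (x := x))) (basisVec i)) f
  rw [SchwartzMap.smulLeftCLM_const, one_smul] at h
  exact h

theorem eulerOp_eq_sum (f : 𝓢(Rd d, 𝕜)) :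
    eulerOp 𝕜 d f = ∑ i : Fin d, coordMul i (∂_{basisVec i} f) := by
  simp only [eulerOp, LinearMap.sum_apply]
  rfl

theorem lapOp_eq_sum (f : 𝓢(Rd d, 𝕜)) :
    lapOp 𝕜 d f = ∑ i : Fin d, ∂_{basisVec i} (∂_{basisVec i} f) := by
  have h := SchwartzMap.laplacian_eq_sum (EuclideanSpace.basisFun (Fin d) ℝ) f
  have h2 : lapOp 𝕜 d f = Δ f := SchwartzMap.laplacianCLM_eq 𝕜 f
  rw [h2, h]
  simp

theorem ouOp_eq_sum (f : 𝓢(Rd d, 𝕜)) : ouOp 𝕜 d f = ∑ i : Fin d,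
    (∂_{basisVec i} (∂_{basisVec i} f) - coordMul i (∂_{basisVec i} f)) := by
  rw [Finset.sum_sub_distrib, ← lapOp_eq_sum, ← eulerOp_eq_sum]
  rfl

/-- Complex conjugation of Schwartz functions. -/
def conjS (f : 𝓢(Rd d, 𝕜)) : 𝓢(Rd d, 𝕜) :=
  SchwartzMap.postcompCLM (RCLike.conjCLE (K := 𝕜) : 𝕜 →L[ℝ] 𝕜) f

theorem conjS_apply (f : 𝓢(Rd d, 𝕜)) (x : Rd d) : conjS f x = (starRingEnd 𝕜) (f x) := rfl

theorem conjS_conjS (f : 𝓢(Rd d, 𝕜)) : conjS (conjS f) = f := by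
  ext x
  simp [conjS_apply]

theorem lineDerivOp_conjS (v : Rd d) (f : 𝓢(Rd d, 𝕜)) : ∂_{v} (conjS f) = conjS (∂_{v} f) := by
  ext x
  rw [SchwartzMap.lineDerivOp_apply_eq_fderiv, conjS_apply, SchwartzMap.lineDerivOp_apply_eq_fderiv]
  have h := ((RCLike.conjCLE (K := 𝕜) : 𝕜 →L[ℝ] 𝕜).hasFDerivAt.comp x (f.hasFDerivAt x)).fderiv
  exact congrArg (fun L : Rd d →L[ℝ] 𝕜 => L v) h

/-- The coefficients are real. This converts sesquilinear identities for the inner product into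
bilinear ones for integrals of products. -/
theorem ouOp_conjS (f : 𝓢(Rd d, 𝕜)) : ouOp 𝕜 d (conjS f) = conjS (ouOp 𝕜 d f) := by
  ext x
  simp only [ouOp_eq_sum, lineDerivOp_conjS, conjS_apply, _root_.sum_apply,
    _root_.sub_apply, coordMul_apply, map_sum, map_sub, map_mul, RCLike.conj_ofReal]

/-- The product of two Schwartz functions. -/
def mulS (f g : 𝓢(Rd d, 𝕜)) : 𝓢(Rd d, 𝕜) :=
  SchwartzMap.pairing (ContinuousLinearMap.mul 𝕜 𝕜) f g

theorem mulS_apply (f g : 𝓢(Rd d, 𝕜)) (x : Rd d) : mulS f g x = f x * g x := rfl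

theorem lineDerivOp_mulS_apply (v : Rd d) (f g : 𝓢(Rd d, 𝕜)) (x : Rd d) :
    ∂_{v} (mulS f g) x = (∂_{v} f) x * g x + f x * (∂_{v} g) x := by
  simp only [SchwartzMap.lineDerivOp_apply_eq_fderiv]
  have h := fderiv_mul (f.differentiableAt (x := x)) (g.differentiableAt (x := x))
  change fderiv ℝ (⇑f * ⇑g) x v = _
  rw [h]
  simp
  ring

end SchwartzCalculus

/-! ### Schwartz functions in `L²(ν)` and the adjoint as a weak equation -/

section L2

variable {𝕜 : Type*} [RCLike 𝕜] {d : ℕ} (ν : Measure (Rd d)) [ν.HasTemperateGrowth]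

theorem inner_schwartzToL2_left (f : 𝓢(Rd d, 𝕜)) (g : Lp 𝕜 2 ν) :
    inner 𝕜 (schwartzToL2 ν f) g = ∫ x, g x * conjS f x ∂ν := by
  rw [L2.inner_def]
  refine integral_congr_ae ?_
  filter_upwards [f.coeFn_toLp 2 ν] with x hx
  rw [RCLike.inner_apply, conjS_apply]
  congr 2

theorem integrable_mul_schwartz (g : Lp 𝕜 2 ν) (f : 𝓢(Rd d, 𝕜)) :
    Integrable (fun x => g x * f x) ν :=
  (Lp.memLp g).integrable_mul (f.memLp 2 ν)

variable [ν.IsOpenPosMeasure]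

theorem mem_graph_onSchwartz_iff (A : 𝓢(Rd d, 𝕜) →ₗ[𝕜] 𝓢(Rd d, 𝕜)) (a b : Lp 𝕜 2 ν) :
    (a, b) ∈ (onSchwartz ν A).graph ↔ ∃ f, a = schwartzToL2 ν f ∧ b = schwartzToL2 ν (A f) := by
  rw [LinearPMap.mem_graph_iff]
  constructor
  · rintro ⟨⟨y, f, rfl⟩, rfl, rfl⟩
    exact ⟨f, rfl, onSchwartz_apply ν A f⟩
  · rintro ⟨f, rfl, rfl⟩
    exact ⟨⟨_, f, rfl⟩, rfl, onSchwartz_apply ν A f⟩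

theorem dense_domain_onSchwartz [IsFiniteMeasureOnCompacts ν]
    (A : 𝓢(Rd d, 𝕜) →ₗ[𝕜] 𝓢(Rd d, 𝕜)) : Dense ((onSchwartz ν A).domain : Set (Lp 𝕜 2 ν)) := by
  have h := SchwartzMap.denseRange_toLpCLM (E := Rd d) (F := 𝕜) (p := 2) (by simp) (μ := ν)
  exact h

theorem mem_graph_adjoint_ouOp_iff [IsFiniteMeasureOnCompacts ν] (g h : Lp 𝕜 2 ν) :
    (g, h) ∈ (onSchwartz ν (ouOp 𝕜 d)).adjoint.graph ↔
      ∀ φ : 𝓢(Rd d, 𝕜), ∫ x, g x * ouOp 𝕜 d φ x ∂ν = ∫ x, h x * φ x ∂ν := by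
  rw [mem_graph_adjoint_iff (dense_domain_onSchwartz ν (ouOp 𝕜 d))]
  constructor
  · intro H φ
    have h1 := H _ _ ((mem_graph_onSchwartz_iff ν (ouOp 𝕜 d) (schwartzToL2 ν (conjS φ))
      (schwartzToL2 ν (ouOp 𝕜 d (conjS φ)))).2 ⟨conjS φ, rfl, rfl⟩)
    rwa [inner_schwartzToL2_left, inner_schwartzToL2_left, ouOp_conjS, conjS_conjS,
      conjS_conjS] at h1
  · intro H a b hab
    obtain ⟨f, rfl, rfl⟩ := (mem_graph_onSchwartz_iff ν (ouOp 𝕜 d) a b).1 hab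
    rw [inner_schwartzToL2_left, inner_schwartzToL2_left, ← ouOp_conjS]
    exact H _

end L2

/-! ### The adjoint with respect to Lebesgue measure -/

section Lebesgue

variable {𝕜 : Type*} [RCLike 𝕜] {d : ℕ}

/-- `∂ᵢ(xᵢ φ) = φ + xᵢ ∂ᵢφ`: the `d` copies of `∫ g φ` cancel the zeroth-order term. -/
theorem solvesDualWeakly_iff (g h : Lp 𝕜 2 (volume : Measure (Rd d))) :
    SolvesDualWeakly g h ↔
      ∀ φ : 𝓢(Rd d, 𝕜), ∫ x, g x * ouOp 𝕜 d φ x = ∫ x, h x * φ x := by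
  refine forall_congr' fun φ => ?_
  have h1 : ∀ i : Fin d,
      ∫ x, g x * lineDeriv ℝ (fun y : Rd d => ((y i : ℝ) : 𝕜) * φ y) x (basisVec i) =
        (∫ x, g x * φ x) + ∫ x, g x * coordMul i (∂_{basisVec i} φ) x := by
    intro i
    rw [← integral_add (integrable_mul_schwartz _ g _) (integrable_mul_schwartz _ g _)]
    refine integral_congr_ae (ae_of_all _ fun x => ?_)
    have h2 : (fun y : Rd d => ((y i : ℝ) : 𝕜) * φ y) = coordMul i φ :=
      funext fun y => (coordMul_apply i φ y).symm
    simp only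
    rw [h2, ← SchwartzMap.lineDerivOp_apply, lineDerivOp_coordMul, _root_.add_apply, mul_add]
  have h3 : ∫ x, g x * ouOp 𝕜 d φ x = (∫ x, g x * Δ (φ : Rd d → 𝕜) x) -
      ∑ i : Fin d, ∫ x, g x * coordMul i (∂_{basisVec i} φ) x := by
    simp only [← lapOp_apply]
    rw [← integral_finsetSum _ fun i _ => integrable_mul_schwartz _ g _,
      ← integral_sub (integrable_mul_schwartz _ g _)
        (integrable_finsetSum _ fun i _ => integrable_mul_schwartz _ g _)]
    refine integral_congr_ae (ae_of_all _ fun x => ?_)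
    simp only [← Finset.mul_sum, ← mul_sub]
    rw [← _root_.sum_apply, ← eulerOp_eq_sum, ← _root_.sub_apply]
    rfl
  simp only [h1, h3, Finset.sum_add_distrib, Finset.sum_const, Finset.card_univ, Fintype.card_fin,
    nsmul_eq_mul]
  rw [← sub_sub, sub_add_eq_add_sub, sub_add_cancel]

theorem integral_mul_ouOp_volume (f φ : 𝓢(Rd d, 𝕜)) :
    ∫ x, f x * ouOp 𝕜 d φ x = ∫ x, ouDualOp 𝕜 d f x * φ x := by
  have hi : ∀ u v : 𝓢(Rd d, 𝕜), Integrable (fun x => u x * v x) := fun u v =>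
    (mulS u v).integrable
  have h1 : ∀ i : Fin d, ∫ x, f x * coordMul i (∂_{basisVec i} φ) x =
      - ∫ x, (f + coordMul i (∂_{basisVec i} f)) x * φ x := by
    intro i
    rw [← lineDerivOp_coordMul, ← SchwartzMap.integral_mul_lineDerivOp_right_eq_neg_left]
    refine integral_congr_ae (ae_of_all _ fun x => ?_)
    simp only [coordMul_apply]
    ring
  have h2 : ∫ x, f x * lapOp 𝕜 d φ x = ∫ x, lapOp 𝕜 d f x * φ x := by
    have e : ∀ u : 𝓢(Rd d, 𝕜), lapOp 𝕜 d u = Δ u := fun u => SchwartzMap.laplacianCLM_eq 𝕜 u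
    rw [e, e]
    exact SchwartzMap.integral_mul_laplacian_right_eq_left f φ
  have h3 : ∀ x, f x * ouOp 𝕜 d φ x =
      f x * lapOp 𝕜 d φ x - ∑ i : Fin d, f x * coordMul i (∂_{basisVec i} φ) x := by
    intro x
    rw [← Finset.mul_sum, ← mul_sub, ← _root_.sum_apply, ← eulerOp_eq_sum,
      ← _root_.sub_apply]
    rfl
  have h4 : ∀ x, ouDualOp 𝕜 d f x * φ x =
      lapOp 𝕜 d f x * φ x + ∑ i : Fin d, (f + coordMul i (∂_{basisVec i} f)) x * φ x := by
    intro x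
    rw [← Finset.sum_mul, ← add_mul, ← _root_.sum_apply, Finset.sum_add_distrib,
      ← eulerOp_eq_sum, ouDualOp_apply, _root_.add_apply, eulerOp_apply, lapOp_apply,
      Finset.sum_const, Finset.card_univ, Fintype.card_fin, ← Nat.cast_smul_eq_nsmul 𝕜,
      _root_.smul_apply, smul_eq_mul, add_assoc, add_comm ((d : 𝕜) * f x)]
  simp only [h3, h4]
  rw [integral_sub (hi _ _) (integrable_finsetSum _ fun i _ => hi _ _),
    integral_add (hi _ _) (integrable_finsetSum _ fun i _ => hi _ _),
    integral_finsetSum _ fun i _ => hi _ _, integral_finsetSum _ fun i _ => hi _ _, h2]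
  simp only [h1, Finset.sum_neg_distrib, sub_neg_eq_add]

theorem ouDualOp_le_adjoint : onSchwartz volume (ouDualOp 𝕜 d) ≤
    (onSchwartz volume (ouOp 𝕜 d)).adjoint := by
  refine LinearPMap.le_graph_iff.1 ?_
  rintro ⟨a, b⟩ hab
  obtain ⟨f, rfl, rfl⟩ := (mem_graph_onSchwartz_iff volume (ouDualOp 𝕜 d) a b).1 hab
  refine (mem_graph_adjoint_ouOp_iff _ _ _).2 fun φ => ?_
  have h : ∀ u v : 𝓢(Rd d, 𝕜), ∫ x, (schwartzToL2 volume u : Rd d → 𝕜) x * v x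
      = ∫ x, u x * v x := fun u v => integral_congr_ae (by
    filter_upwards [u.coeFn_toLp 2 volume] with x hx
    congr 1)
  rw [h, h, integral_mul_ouOp_volume]

end Lebesgue

/-! ### Integration by parts, symmetry and dissipativity for the Gaussian measure -/

section Gauss

variable {𝕜 : Type*} [RCLike 𝕜] {d : ℕ}

theorem integral_gauss {E : Type*} [NormedAddCommGroup E] [NormedSpace ℝ E] (F : Rd d → E) :
    ∫ x, F x ∂(gauss d) = ∫ x, rho d x • F x := by
  rw [gauss, integral_withDensity_eq_integral_toReal_smul₀
    (continuous_rho d).measurable.ennreal_ofReal.aemeasurable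
    (ae_of_all _ fun _ => ENNReal.ofReal_lt_top)]
  simp only [ENNReal.toReal_ofReal (rho_pos d _).le]

theorem hasFDerivAt_rho (x : Rd d) :
    HasFDerivAt (rho d) (-(rho d x) • innerSL ℝ x) x := by
  have h1 : HasFDerivAt (fun y : Rd d => ‖y‖ ^ 2) (2 • innerSL ℝ x) x :=
    (hasStrictFDerivAt_norm_sq x).hasFDerivAt
  have h2 := ((h1.neg.mul_const (2⁻¹ : ℝ)).exp.mul_const ((2 * Real.pi) ^ ((d : ℝ) / 2))⁻¹)
  have h3 : rho d = fun y => Real.exp ((-‖y‖ ^ 2) * 2⁻¹) * ((2 * Real.pi) ^ ((d : ℝ) / 2))⁻¹ := by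
    funext y
    rw [rho, div_eq_mul_inv, div_eq_mul_inv]
  have h4 : -(rho d x) • innerSL ℝ x = ((2 * Real.pi) ^ ((d : ℝ) / 2))⁻¹ •
      (Real.exp ((-‖x‖ ^ 2) * 2⁻¹) • ((2⁻¹ : ℝ) • (-(2 • innerSL ℝ x)))) := by
    rw [h3]
    ext y
    simp
    ring
  rw [h4, h3]
  exact h2

theorem rho_le (x : Rd d) : rho d x ≤ ((2 * Real.pi) ^ ((d : ℝ) / 2))⁻¹ := by
  rw [rho, div_eq_mul_inv]
  refine mul_le_of_le_one_left (by positivity) ?_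
  rw [Real.exp_le_one_iff]
  have := sq_nonneg ‖x‖
  linarith

theorem integrable_rho_smul (w : 𝓢(Rd d, 𝕜)) : Integrable fun x => rho d x • w x := by
  refine w.integrable.bdd_smul ((2 * Real.pi) ^ ((d : ℝ) / 2))⁻¹
    (continuous_rho d).aestronglyMeasurable (ae_of_all _ fun x => ?_)
  rw [Real.norm_of_nonneg (rho_pos d x).le]
  exact rho_le x

/-- Integration by parts for the Gaussian measure. -/
theorem integral_lineDerivOp_gauss (i : Fin d) (w : 𝓢(Rd d, 𝕜)) :
    ∫ x, (∂_{basisVec i} w) x ∂(gauss d) = ∫ x, coordMul i w x ∂(gauss d) := by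
  have e : ∀ x : Rd d, fderiv ℝ (rho d) x (basisVec i) = -(x i * rho d x) := by
    intro x
    rw [(hasFDerivAt_rho x).fderiv]
    simp [EuclideanSpace.inner_single_right]
    ring
  have e2 : ∀ x : Rd d, fderiv ℝ (rho d) x (basisVec i) • w x = -(rho d x • coordMul i w x) := by
    intro x
    rw [e, coordMul_apply, RCLike.real_smul_eq_coe_mul, RCLike.real_smul_eq_coe_mul]
    push_cast
    ring
  rw [integral_gauss, integral_gauss]
  -- Lebesgue integration by parts for the pair `ρ`, `w`; the derivative falls on `ρ` as `-xᵢ ρ`.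
  have h := integral_smul_fderiv_eq_neg_fderiv_smul_of_integrable (μ := (volume : Measure (Rd d)))
    (f := rho d) (g := w) (v := basisVec i) ?_ ?_ (integrable_rho_smul w)
    (fun x _ => (hasFDerivAt_rho x).differentiableAt) (fun x _ => w.differentiableAt)
  · simp only [e2, integral_neg, neg_neg] at h
    simpa only [SchwartzMap.lineDerivOp_apply_eq_fderiv] using h
  · simp only [e2]
    exact (integrable_rho_smul _).neg
  · simpa only [SchwartzMap.lineDerivOp_apply_eq_fderiv] using
      integrable_rho_smul (∂_{basisVec i} w)

theorem integral_ouOp_gauss (f : 𝓢(Rd d, 𝕜)) : ∫ x, ouOp 𝕜 d f x ∂(gauss d) = 0 := by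
  simp only [ouOp_eq_sum, _root_.sum_apply]
  rw [integral_finsetSum _ fun i _ => (SchwartzMap.integrable _)]
  refine Finset.sum_eq_zero fun i _ => ?_
  simp only [_root_.sub_apply]
  rw [integral_sub (SchwartzMap.integrable _) (SchwartzMap.integrable _),
    integral_lineDerivOp_gauss, sub_self]

/-- The Dirichlet form: Gaussian integration by parts applied to `u ∂ᵢv`. The right-hand side is
symmetric in `u` and `v`, and nonpositive for `u = conj v`. -/
theorem integral_mul_ouOp_gauss (u v : 𝓢(Rd d, 𝕜)) :
    ∫ x, u x * ouOp 𝕜 d v x ∂(gauss d) =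
      - ∑ i : Fin d, ∫ x, (∂_{basisVec i} u) x * (∂_{basisVec i} v) x ∂(gauss d) := by
  have hi : ∀ u v : 𝓢(Rd d, 𝕜), Integrable (fun x => u x * v x) (gauss d) := fun u v =>
    (mulS u v).integrable
  have h1 : ∀ i : Fin d, ∫ x, u x * (∂_{basisVec i} (∂_{basisVec i} v) -
      coordMul i (∂_{basisVec i} v)) x ∂(gauss d) =
      - ∫ x, (∂_{basisVec i} u) x * (∂_{basisVec i} v) x ∂(gauss d) := by
    intro i
    have h2 := integral_lineDerivOp_gauss i (mulS u (∂_{basisVec i} v))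
    have h3 : ∀ x, coordMul i (mulS u (∂_{basisVec i} v)) x =
        u x * coordMul i (∂_{basisVec i} v) x := fun x => by
      rw [coordMul_apply, coordMul_apply, mulS_apply]; ring
    simp only [lineDerivOp_mulS_apply, h3] at h2
    rw [integral_add (hi _ _) (hi _ _)] at h2
    simp only [_root_.sub_apply, mul_sub]
    rw [integral_sub (hi _ _) (hi _ _), ← h2]
    ring
  simp only [ouOp_eq_sum, _root_.sum_apply, Finset.mul_sum]
  rw [integral_finsetSum _ fun i _ => hi _ _, ← Finset.sum_neg_distrib]
  exact Finset.sum_congr rfl fun i _ => h1 i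

theorem integral_mul_ouOp_gauss_comm (u v : 𝓢(Rd d, 𝕜)) :
    ∫ x, u x * ouOp 𝕜 d v x ∂(gauss d) = ∫ x, v x * ouOp 𝕜 d u x ∂(gauss d) := by
  rw [integral_mul_ouOp_gauss, integral_mul_ouOp_gauss]
  simp only [mul_comm]

theorem inner_schwartzToL2 (ν : Measure (Rd d)) [ν.HasTemperateGrowth] (f g : 𝓢(Rd d, 𝕜)) :
    inner 𝕜 (schwartzToL2 ν f) (schwartzToL2 ν g) = ∫ x, g x * conjS f x ∂ν := by
  rw [inner_schwartzToL2_left]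
  refine integral_congr_ae ?_
  filter_upwards [g.coeFn_toLp 2 ν] with x hx
  congr 1

theorem isGraphSymmetric_ouOp : IsGraphSymmetric (onSchwartz (gauss d) (ouOp 𝕜 d)) := by
  intro x y a b hxy hab
  obtain ⟨f, rfl, rfl⟩ := (mem_graph_onSchwartz_iff (gauss d) (ouOp 𝕜 d) x y).1 hxy
  obtain ⟨g, rfl, rfl⟩ := (mem_graph_onSchwartz_iff (gauss d) (ouOp 𝕜 d) a b).1 hab
  rw [inner_schwartzToL2, inner_schwartzToL2, ← ouOp_conjS, integral_mul_ouOp_gauss_comm]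
  simp only [mul_comm]

theorem isDissipative_ouOp : IsDissipative (onSchwartz (gauss d) (ouOp 𝕜 d)) := by
  intro x y hxy
  obtain ⟨f, rfl, rfl⟩ := (mem_graph_onSchwartz_iff (gauss d) (ouOp 𝕜 d) x y).1 hxy
  rw [inner_schwartzToL2, ← ouOp_conjS, integral_mul_ouOp_gauss, map_neg, map_sum, neg_nonpos]
  refine Finset.sum_nonneg fun i _ => ?_
  have h : ∀ x, (∂_{basisVec i} f) x * (∂_{basisVec i} (conjS f)) x =
      ((‖(∂_{basisVec i} f) x‖ ^ 2 : ℝ) : 𝕜) := fun x => by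
    rw [lineDerivOp_conjS, conjS_apply, RCLike.mul_conj]
    push_cast
    rfl
  simp only [h]
  rw [integral_ofReal, RCLike.ofReal_re]
  exact integral_nonneg fun x => by positivity

theorem isOperatorInvariant_ouOp :
    IsOperatorInvariant (gauss d) (onSchwartz (gauss d) (ouOp 𝕜 d)) := by
  refine ⟨dense_domain_onSchwartz _ _, ?_⟩
  rintro ⟨_, f, rfl⟩
  have h : onSchwartz (gauss d) (ouOp 𝕜 d) ⟨schwartzToL2 (gauss d) f, f, rfl⟩ =
    schwartzToL2 (gauss d) (ouOp 𝕜 d f) := onSchwartz_apply _ _ f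
  have h2 : (schwartzToL2 (gauss d) (ouOp 𝕜 d f) : Rd d → 𝕜) =ᵐ[gauss d] ouOp 𝕜 d f :=
    (ouOp 𝕜 d f).coeFn_toLp 2 (gauss d)
  rw [h]
  exact ⟨(ouOp 𝕜 d f).integrable.congr h2.symm, (integral_congr_ae h2).trans (integral_ouOp_gauss f)⟩

end Gauss

/-! ### A square integrable function with vanishing Gaussian moments is zero -/

section Moments

variable {𝕜 : Type*} [RCLike 𝕜] {d : ℕ}

theorem integrable_exp_inner_gauss (b : Rd d) :
    Integrable (fun x => Real.exp (inner ℝ b x)) (gauss d) := by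
  rw [gauss, integrable_withDensity_iff_integrable_smul₀'
    (continuous_rho d).measurable.ennreal_ofReal.aemeasurable
    (ae_of_all _ fun _ => ENNReal.ofReal_lt_top)]
  have h := (GaussianFourier.integrable_cexp_neg_mul_sq_norm_add (V := Rd d) (b := 1 / 2)
    (by norm_num) 1 b).norm.mul_const ((2 * Real.pi) ^ ((d : ℝ) / 2))⁻¹
  refine h.congr (ae_of_all _ fun x => ?_)
  simp only [ENNReal.toReal_ofReal (rho_pos d x).le, smul_eq_mul]
  have e : (-(1 / 2) * (‖x‖ : ℂ) ^ 2 + 1 * ((inner ℝ b x : ℝ) : ℂ)).re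
      = -‖x‖ ^ 2 / 2 + inner ℝ b x := by
    rw [one_mul, show (-(1 / 2) * (‖x‖ : ℂ) ^ 2 + ((inner ℝ b x : ℝ) : ℂ))
      = (((-‖x‖ ^ 2 / 2 + inner ℝ b x : ℝ)) : ℂ) by push_cast; ring, Complex.ofReal_re]
  rw [Complex.norm_exp, e, Real.exp_add, rho]
  ring

/-- The square is dominated through `exp (2|r|) ≤ exp (2r) + exp (-2r)`. This exponential is the
common majorant for all moment integrals. -/
theorem memLp_exp_abs_inner_gauss (a : Rd d) :
    MemLp (fun x => Real.exp |inner ℝ a x|) 2 (gauss d) := by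
  have hm : Continuous fun x : Rd d => Real.exp |inner ℝ a x| := by fun_prop
  rw [memLp_two_iff_integrable_sq hm.aestronglyMeasurable]
  refine ((integrable_exp_inner_gauss ((2 : ℝ) • a)).add
    (integrable_exp_inner_gauss ((-2 : ℝ) • a))).mono' (hm.pow 2).aestronglyMeasurable
    (ae_of_all _ fun x => ?_)
  rw [Real.norm_of_nonneg (by positivity), ← Real.exp_nat_mul]
  simp only [Pi.add_apply, inner_smul_left, conj_trivial]
  push_cast
  rcases abs_cases (inner ℝ a x) with ⟨h, -⟩ | ⟨h, -⟩ <;> rw [h]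
  · have := Real.exp_pos (-2 * inner ℝ a x)
    linarith
  · have := Real.exp_pos (2 * inner ℝ a x)
    rw [mul_neg, ← neg_mul]
    linarith

theorem integrable_norm_mul_exp {E : Type*} [NormedAddCommGroup E] {u : Rd d → E}
    (hu : MemLp u 2 (gauss d)) (a : Rd d) :
    Integrable (fun x => ‖u x‖ * Real.exp |inner ℝ a x|) (gauss d) :=
  hu.norm.integrable_mul (memLp_exp_abs_inner_gauss a)

theorem norm_inner_pow_le (a x : Rd d) (n : ℕ) :
    ‖(((inner ℝ a x) ^ n : ℝ) : 𝕜)‖ ≤ n.factorial * Real.exp |inner ℝ a x| := by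
  have h := Real.pow_div_factorial_le_exp |inner ℝ a x| (abs_nonneg _) n
  rw [div_le_iff₀ (by positivity)] at h
  rw [RCLike.norm_ofReal, abs_pow, mul_comm]
  exact h

theorem integrable_mul_inner_pow {u : Rd d → 𝕜} (hu : MemLp u 2 (gauss d)) (a : Rd d) (n : ℕ) :
    Integrable (fun x => u x * (((inner ℝ a x) ^ n : ℝ) : 𝕜)) (gauss d) := by
  refine ((integrable_norm_mul_exp hu a).const_mul (n.factorial : ℝ)).mono' ?_
    (ae_of_all _ fun x => ?_)
  · refine hu.1.mul (Continuous.aestronglyMeasurable ?_)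
    fun_prop
  · rw [norm_mul]
    have := mul_le_mul_of_nonneg_left (norm_inner_pow_le (𝕜 := 𝕜) a x n) (norm_nonneg (u x))
    linarith

/-- Expand the exponential in its power series. The absolute values of the terms sum to `|u| exp
|⟪a, x⟫|`, which is integrable, so the series may be integrated term by term. -/
theorem integral_mul_cexp_eq_zero {u : Rd d → ℝ} (hu : MemLp u 2 (gauss d)) (a : Rd d)
    (h : ∀ n : ℕ, ∫ x, u x * (inner ℝ a x) ^ n ∂(gauss d) = 0) :
    ∫ x, (u x : ℂ) * Complex.exp (((inner ℝ a x : ℝ) : ℂ) * Complex.I) ∂(gauss d) = 0 := by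
  have hs := hasSum_integral_of_dominated_convergence (μ := gauss d)
    (F := fun (n : ℕ) x => (u x : ℂ) *
      ((((inner ℝ a x : ℝ) : ℂ) * Complex.I) ^ n / (n.factorial : ℂ)))
    (f := fun x => (u x : ℂ) * Complex.exp (((inner ℝ a x : ℝ) : ℂ) * Complex.I))
    (fun n x => |u x| * (|inner ℝ a x| ^ n / n.factorial)) ?_ ?_ ?_ ?_ ?_
  · have h0 : ∀ n : ℕ, ∫ x, (u x : ℂ) *
        ((((inner ℝ a x : ℝ) : ℂ) * Complex.I) ^ n / (n.factorial : ℂ)) ∂(gauss d) = 0 := by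
      intro n
      have e : ∀ x, (u x : ℂ) * ((((inner ℝ a x : ℝ) : ℂ) * Complex.I) ^ n / (n.factorial : ℂ)) =
          ((u x * (inner ℝ a x) ^ n : ℝ) : ℂ) * (Complex.I ^ n / (n.factorial : ℂ)) := fun x => by
        push_cast
        ring
      simp only [e]
      rw [integral_mul_const, integral_complex_ofReal, h n]
      simp
    simp only [h0] at hs
    exact hs.unique hasSum_zero
  · intro n
    refine (Complex.continuous_ofReal.comp_aestronglyMeasurable hu.1).mul
      (Continuous.aestronglyMeasurable ?_)
    fun_prop
  · intro n
    refine ae_of_all _ fun x => le_of_eq ?_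
    simp
  · exact ae_of_all _ fun x => (Real.summable_pow_div_factorial _).mul_left _
  · refine (integrable_norm_mul_exp hu a).congr (ae_of_all _ fun x => ?_)
    simp only [tsum_mul_left, Real.norm_eq_abs]
    rw [Real.exp_eq_exp_ℝ, NormedSpace.exp_eq_tsum_div]
  · refine ae_of_all _ fun x => HasSum.mul_left _ ?_
    rw [Complex.exp_eq_exp_ℂ]
    exact NormedSpace.expSeries_div_hasSum_exp _

/-- The finite measures `u⁺ μ` and `u⁻ μ` have the same characteristic function, hence coincide. So
`u⁺ = u⁻` almost everywhere, and both vanish. -/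
theorem ae_eq_zero_of_moments_real {u : Rd d → ℝ} (hu : MemLp u 2 (gauss d))
    (h : ∀ (a : Rd d) (n : ℕ), ∫ x, u x * (inner ℝ a x) ^ n ∂(gauss d) = 0) :
    u =ᵐ[gauss d] 0 := by
  have hi : Integrable u (gauss d) := hu.integrable (by norm_num)
  have hf1 := isFiniteMeasure_withDensity_ofReal hi.2
  have hf2 := isFiniteMeasure_withDensity_ofReal hi.neg.2
  have hm1 : AEMeasurable (fun x => ENNReal.ofReal (u x)) (gauss d) := hi.1.aemeasurable.ennreal_ofReal
  have hm2 : AEMeasurable (fun x => ENNReal.ofReal ((-u) x)) (gauss d) :=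
    hi.neg.1.aemeasurable.ennreal_ofReal
  have hlt : ∀ v : Rd d → ℝ, ∀ᵐ x ∂(gauss d), ENNReal.ofReal (v x) < ⊤ :=
    fun v => ae_of_all _ fun _ => ENNReal.ofReal_lt_top
  have heq : (gauss d).withDensity (fun x => ENNReal.ofReal (u x)) =
      (gauss d).withDensity (fun x => ENNReal.ofReal ((-u) x)) := by
    refine Measure.ext_of_charFun (funext fun a => ?_)
    rw [charFun_apply, charFun_apply, integral_withDensity_eq_integral_toReal_smul₀ hm1 (hlt u),
      integral_withDensity_eq_integral_toReal_smul₀ hm2 (hlt (-u)), ← sub_eq_zero]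
    have hint : ∀ v : Rd d → ℝ, AEMeasurable (fun x => ENNReal.ofReal (v x)) (gauss d) →
        IsFiniteMeasure ((gauss d).withDensity (fun x => ENNReal.ofReal (v x))) →
        Integrable (fun x => (ENNReal.ofReal (v x)).toReal •
          Complex.exp (((inner ℝ x a : ℝ) : ℂ) * Complex.I)) (gauss d) := by
      intro v hv hfin
      rw [← integrable_withDensity_iff_integrable_smul₀' hv (hlt v)]
      refine (integrable_const (1 : ℝ)).mono' (Continuous.aestronglyMeasurable (by fun_prop))
        (ae_of_all _ fun x => ?_)
      rw [Complex.norm_exp_ofReal_mul_I]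
    rw [← integral_sub (hint u hm1 hf1) (hint (-u) hm2 hf2)]
    refine Eq.trans (integral_congr_ae (ae_of_all _ fun x => ?_))
      (integral_mul_cexp_eq_zero hu a (h a))
    simp only
    rw [← sub_smul, real_inner_comm, ENNReal.toReal_ofReal', ENNReal.toReal_ofReal',
      Complex.real_smul]
    congr 2
    rcases le_total (u x) 0 with h0 | h0 <;> simp [h0]
  have h1 := (withDensity_eq_iff hm1 hm2 (by
    have := hf1.measure_univ_lt_top
    rw [withDensity_apply _ MeasurableSet.univ, Measure.restrict_univ] at this
    exact this.ne)).1 heq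
  filter_upwards [h1] with x hx
  rcases le_total (u x) 0 with h0 | h0
  · have h2 : ENNReal.ofReal ((-u) x) = 0 := by rw [← hx, ENNReal.ofReal_of_nonpos h0]
    have h3 : -u x ≤ 0 := ENNReal.ofReal_eq_zero.1 h2
    exact le_antisymm h0 (neg_nonpos.1 h3)
  · have h2 : ENNReal.ofReal (u x) = 0 := by
      rw [hx, ENNReal.ofReal_of_nonpos (by simpa using h0)]
    exact le_antisymm (ENNReal.ofReal_eq_zero.1 h2) h0

/-- A square integrable function with respect to the Gaussian measure all of whose moments vanish
is zero: polynomials are dense. -/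
theorem ae_eq_zero_of_moments {u : Rd d → 𝕜} (hu : MemLp u 2 (gauss d))
    (h : ∀ (a : Rd d) (n : ℕ), ∫ x, u x * (((inner ℝ a x) ^ n : ℝ) : 𝕜) ∂(gauss d) = 0) :
    u =ᵐ[gauss d] 0 := by
  have hre := ae_eq_zero_of_moments_real hu.re fun a n => by
    have h1 := integral_re (integrable_mul_inner_pow hu a n)
    rw [h a n, map_zero] at h1
    simpa only [RCLike.re_mul_ofReal] using h1
  have him := ae_eq_zero_of_moments_real hu.im fun a n => by
    have h1 := integral_im (integrable_mul_inner_pow hu a n)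
    rw [h a n, map_zero] at h1
    simpa only [RCLike.im_mul_ofReal] using h1
  filter_upwards [hre, him] with x h1 h2
  exact RCLike.ext (by simpa using h1) (by simpa using h2)

end Moments

/-! ### Truncated polynomials as test functions, and density of the range -/

section TestFunctions

variable {𝕜 : Type*} [RCLike 𝕜] {d : ℕ}

theorem hasTemperateGrowth_inner_pow (a : Rd d) (n : ℕ) :
    Function.HasTemperateGrowth fun x : Rd d => (((inner ℝ a x) ^ n : ℝ) : 𝕜) := by
  have h := (hasTemperateGrowth_ofReal_clm (𝕜 := 𝕜) (innerSL ℝ a)).pow n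
  have e : (fun x : Rd d => (((inner ℝ a x) ^ n : ℝ) : 𝕜)) =
      (fun x => ((innerSL ℝ a x : ℝ) : 𝕜)) ^ n := by
    funext x
    rw [Pi.pow_apply, RCLike.ofReal_pow, innerSL_apply_apply]
  rw [e]
  exact h

/-- Multiplication by the `n`-th power of the linear form `⟪a, ·⟫`. -/
def innerPowMul (a : Rd d) (n : ℕ) : 𝓢(Rd d, 𝕜) →L[𝕜] 𝓢(Rd d, 𝕜) :=
  SchwartzMap.smulLeftCLM 𝕜 fun x : Rd d => (((inner ℝ a x) ^ n : ℝ) : 𝕜)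

theorem innerPowMul_apply (a : Rd d) (n : ℕ) (f : 𝓢(Rd d, 𝕜)) (x : Rd d) :
    innerPowMul a n f x = (((inner ℝ a x) ^ n : ℝ) : 𝕜) * f x :=
  SchwartzMap.smulLeftCLM_apply_apply (hasTemperateGrowth_inner_pow a n) f x

theorem lineDerivOp_innerPowMul (a : Rd d) (n : ℕ) (i : Fin d) (f : 𝓢(Rd d, 𝕜)) :
    ∂_{basisVec i} (innerPowMul a n f) = ((n : 𝕜) * ((a i : ℝ) : 𝕜)) • innerPowMul a (n - 1) f +
      innerPowMul a n (∂_{basisVec i} f) := by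
  have h := lineDerivOp_smulLeftCLM (𝕜 := 𝕜) (v := basisVec i)
    (p' := ((n : 𝕜) * ((a i : ℝ) : 𝕜)) • fun x : Rd d => (((inner ℝ a x) ^ (n - 1) : ℝ) : 𝕜))
    (hasTemperateGrowth_inner_pow a n)
    ((Function.HasTemperateGrowth.const _).mul (hasTemperateGrowth_inner_pow a (n - 1)))
    (fun x => by
      have h1 : HasFDerivAt (fun y : Rd d => (inner ℝ a y) ^ n)
          ((n • (inner ℝ a x) ^ (n - 1)) • innerSL ℝ a) x :=
        ((innerSL ℝ a).hasFDerivAt (x := x)).pow n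
      have h2 := ((RCLike.ofRealCLM (K := 𝕜)).hasFDerivAt.comp x h1).fderiv
      have h3 := congrArg (fun L : Rd d →L[ℝ] 𝕜 => L (basisVec i)) h2
      refine h3.trans ?_
      simp [EuclideanSpace.inner_single_right]
      ring) f
  rw [SchwartzMap.smulLeftCLM_smul (hasTemperateGrowth_inner_pow a (n - 1))] at h
  exact h

/-- Leibniz rule: the Laplacian of `⟪a, x⟫ⁿ` gives the first term, the cross gradients the second,
and Euler's identity for degree `n` the third. The truncated exponents `n - 1` and `n - 2` are
harmless, as their coefficients vanish where truncation occurs. -/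
theorem ouOp_innerPowMul (a : Rd d) (n : ℕ) (f : 𝓢(Rd d, 𝕜)) :
    ouOp 𝕜 d (innerPowMul a n f) =
      ((n : 𝕜) * ((n - 1 : ℕ) : 𝕜) * ((‖a‖ ^ 2 : ℝ) : 𝕜)) • innerPowMul a (n - 2) f
      + (2 * (n : 𝕜)) • (∑ i : Fin d, ((a i : ℝ) : 𝕜) • innerPowMul a (n - 1) (∂_{basisVec i} f))
      - (n : 𝕜) • innerPowMul a n f + innerPowMul a n (lapOp 𝕜 d f)
      - innerPowMul a n (eulerOp 𝕜 d f) := by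
  ext x
  have hn : ((‖a‖ ^ 2 : ℝ) : 𝕜) = ∑ i : Fin d, ((a i : ℝ) : 𝕜) ^ 2 := by
    rw [EuclideanSpace.real_norm_sq_eq]; push_cast; rfl
  have hx : ((inner ℝ a x : ℝ) : 𝕜) = ∑ i : Fin d, ((x i : ℝ) : 𝕜) * ((a i : ℝ) : 𝕜) := by
    rw [PiLp.inner_apply]; simp
  have hnx : (n : 𝕜) * (((inner ℝ a x) ^ n : ℝ) : 𝕜) =
      (n : 𝕜) * ((((inner ℝ a x) ^ (n - 1) : ℝ) : 𝕜) * ((inner ℝ a x : ℝ) : 𝕜)) := by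
    rcases n with _ | n
    · simp
    · rw [Nat.add_sub_cancel, ← RCLike.ofReal_mul, ← pow_succ]
  have h2 : n - 1 - 1 = n - 2 := by omega
  simp only [ouOp_eq_sum, lapOp_eq_sum, eulerOp_eq_sum, lineDerivOp_innerPowMul, map_sum,
    LineDeriv.lineDerivOp_add, LineDeriv.lineDerivOp_smul, _root_.sum_apply, _root_.sub_apply,
    _root_.add_apply, _root_.smul_apply, coordMul_apply, innerPowMul_apply, smul_eq_mul, h2, hn]
  rw [← mul_assoc (n : 𝕜) (((inner ℝ a x) ^ n : ℝ) : 𝕜), hnx, hx]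
  simp only [Finset.mul_sum, Finset.sum_mul, ← Finset.sum_add_distrib, ← Finset.sum_sub_distrib]
  refine Finset.sum_congr rfl fun i _ => ?_
  ring

/-- Dilation `f ↦ f (s ·)` of Schwartz functions. -/
def dilate (s : ℝˣ) : 𝓢(Rd d, 𝕜) →L[𝕜] 𝓢(Rd d, 𝕜) :=
  SchwartzMap.compCLMOfContinuousLinearEquiv 𝕜 (ContinuousLinearEquiv.smulLeft (R₁ := ℝ) s)

theorem dilate_apply (s : ℝˣ) (f : 𝓢(Rd d, 𝕜)) (x : Rd d) :
    dilate s f x = f ((s : ℝ) • x) := rfl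

theorem lineDerivOp_dilate (s : ℝˣ) (v : Rd d) (f : 𝓢(Rd d, 𝕜)) :
    ∂_{v} (dilate s f) = ((s : ℝ) : 𝕜) • dilate s (∂_{v} f) := by
  have h := SchwartzMap.lineDerivOp_compCLMOfContinuousLinearEquiv 𝕜 v
    (ContinuousLinearEquiv.smulLeft (R₁ := ℝ) s : Rd d ≃L[ℝ] Rd d) f
  have h2 : (ContinuousLinearEquiv.smulLeft (R₁ := ℝ) s : Rd d ≃L[ℝ] Rd d) v = (s : ℝ) • v := rfl
  rw [h2, LineDeriv.lineDerivOp_left_smul] at h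
  rw [dilate, h]
  ext x
  exact RCLike.real_smul_eq_coe_mul _ _

theorem lapOp_dilate (s : ℝˣ) (f : 𝓢(Rd d, 𝕜)) :
    lapOp 𝕜 d (dilate s f) = (((s : ℝ) : 𝕜) ^ 2) • dilate s (lapOp 𝕜 d f) := by
  simp only [lapOp_eq_sum, lineDerivOp_dilate, LineDeriv.lineDerivOp_smul, map_sum,
    Finset.smul_sum, smul_smul, pow_two]

/-- The Euler operator is scale invariant, so unlike the other derivatives it gains no power of `s`.
-/
theorem eulerOp_dilate (s : ℝˣ) (f : 𝓢(Rd d, 𝕜)) :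
    eulerOp 𝕜 d (dilate s f) = dilate s (eulerOp 𝕜 d f) := by
  simp only [eulerOp_eq_sum, lineDerivOp_dilate, map_sum]
  refine Finset.sum_congr rfl fun i _ => ?_
  ext x
  simp only [coordMul_apply, _root_.smul_apply, dilate_apply, smul_eq_mul, PiLp.smul_apply]
  push_cast
  ring

theorem exists_norm_le (f : 𝓢(Rd d, 𝕜)) : ∃ C, ∀ x, ‖f x‖ ≤ C :=
  ⟨_, SchwartzMap.norm_le_seminorm ℝ f⟩

theorem exists_schwartz_apply_zero : ∃ f : 𝓢(Rd d, 𝕜), f 0 = 1 := by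
  let b : ContDiffBump (0 : Rd d) := ⟨1, 2, one_pos, one_lt_two⟩
  have h1 : HasCompactSupport fun x => ((b x : ℝ) : 𝕜) :=
    b.hasCompactSupport.comp_left (g := fun r : ℝ => (r : 𝕜)) RCLike.ofReal_zero
  have h2 : ContDiff ℝ ((⊤ : ℕ∞) : WithTop ℕ∞) fun x => ((b x : ℝ) : 𝕜) :=
    (RCLike.ofRealCLM (K := 𝕜)).contDiff.comp b.contDiff
  refine ⟨h1.toSchwartzMap h2, ?_⟩
  change ((b 0 : ℝ) : 𝕜) = 1
  rw [b.one_of_mem_closedBall (by simp [b]), RCLike.ofReal_one]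

theorem tendsto_integral_dilate {u : Rd d → 𝕜} (hu : MemLp u 2 (gauss d)) (a : Rd d) (n : ℕ)
    {s : ℕ → ℝˣ} (hs : Tendsto (fun k => (s k : ℝ)) atTop (𝓝 0)) (f : 𝓢(Rd d, 𝕜)) :
    Tendsto (fun k => ∫ x, u x * innerPowMul a n (dilate (s k) f) x ∂(gauss d)) atTop
      (𝓝 ((∫ x, u x * (((inner ℝ a x) ^ n : ℝ) : 𝕜) ∂(gauss d)) * f 0)) := by
  obtain ⟨C, hC⟩ := exists_norm_le f
  rw [← integral_mul_const]
  refine tendsto_integral_of_dominated_convergence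
    (fun x => ‖u x * (((inner ℝ a x) ^ n : ℝ) : 𝕜)‖ * C) (fun k => ?_)
    ((integrable_mul_inner_pow hu a n).norm.mul_const C) (fun k => ae_of_all _ fun x => ?_)
    (ae_of_all _ fun x => ?_)
  · exact hu.1.mul (SchwartzMap.continuous _).aestronglyMeasurable
  · rw [innerPowMul_apply, dilate_apply, ← mul_assoc, norm_mul]
    exact mul_le_mul_of_nonneg_left (hC _) (norm_nonneg _)
  · simp only [innerPowMul_apply, dilate_apply, ← mul_assoc]
    refine Tendsto.const_mul _ ?_
    have h1 : Tendsto (fun k => (s k : ℝ) • x) atTop (𝓝 0) := by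
      simpa using hs.smul_const x
    exact (f.continuous.tendsto 0).comp h1

/-- Test against `⟪a, x⟫ⁿ χ(s x)` with `χ 0 = 1` and let `s → 0`. Terms where a derivative hits the
cutoff carry a factor `s` or `s²`, except the Euler term. -/
theorem moment_recursion {u : Rd d → 𝕜} (hu : MemLp u 2 (gauss d)) {c : 𝕜}
    (h : ∀ f : 𝓢(Rd d, 𝕜), ∫ x, u x * (c • f - ouOp 𝕜 d f) x ∂(gauss d) = 0) (a : Rd d) (n : ℕ) :
    (c + n) * ∫ x, u x * (((inner ℝ a x) ^ n : ℝ) : 𝕜) ∂(gauss d) =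
      (n : 𝕜) * ((n - 1 : ℕ) : 𝕜) * ((‖a‖ ^ 2 : ℝ) : 𝕜) *
        ∫ x, u x * (((inner ℝ a x) ^ (n - 2) : ℝ) : 𝕜) ∂(gauss d) := by
  obtain ⟨χ, hχ⟩ := exists_schwartz_apply_zero (𝕜 := 𝕜) (d := d)
  let s : ℕ → ℝˣ := fun k => Units.mk0 (1 / ((k : ℝ) + 1)) (by positivity)
  have hs : Tendsto (fun k => (s k : ℝ)) atTop (𝓝 0) := tendsto_one_div_add_atTop_nhds_zero_nat
  have hs' : Tendsto (fun k => ((s k : ℝ) : 𝕜)) atTop (𝓝 0) := by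
    simpa [Function.comp_def] using ((RCLike.continuous_ofReal (K := 𝕜)).tendsto (0 : ℝ)).comp hs
  have hi : ∀ f : 𝓢(Rd d, 𝕜), Integrable (fun x => u x * f x) (gauss d) := fun f =>
    hu.integrable_mul (f.memLp 2 _)
  let J : 𝓢(Rd d, 𝕜) →ₗ[𝕜] 𝕜 :=
    { toFun := fun f => ∫ x, u x * f x ∂(gauss d)
      map_add' := fun f g => by
        simp only [_root_.add_apply, mul_add]
        exact integral_add (hi f) (hi g)
      map_smul' := fun r f => by
        simp only [_root_.smul_apply, smul_eq_mul, mul_left_comm, RingHom.id_apply]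
        exact integral_const_mul _ _ }
  have hJ : ∀ f, J (c • f - ouOp 𝕜 d f) = 0 := h
  let I : ℕ → 𝓢(Rd d, 𝕜) → ℕ → 𝕜 := fun m f k => J (innerPowMul a m (dilate (s k) f))
  have hI : ∀ m f, Tendsto (I m f) atTop
      (𝓝 ((∫ x, u x * (((inner ℝ a x) ^ m : ℝ) : 𝕜) ∂(gauss d)) * f 0)) := fun m f =>
    tendsto_integral_dilate hu a m hs f
  have key : ∀ k, (c + n) * I n χ k
      - (n : 𝕜) * ((n - 1 : ℕ) : 𝕜) * ((‖a‖ ^ 2 : ℝ) : 𝕜) * I (n - 2) χ k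
      - ((s k : ℝ) : 𝕜) * (2 * (n : 𝕜) *
        ∑ i : Fin d, ((a i : ℝ) : 𝕜) * I (n - 1) (∂_{basisVec i} χ) k)
      - ((s k : ℝ) : 𝕜) ^ 2 * I n (lapOp 𝕜 d χ) k + I n (eulerOp 𝕜 d χ) k = 0 := by
    intro k
    rw [← hJ (innerPowMul a n (dilate (s k) χ)), ouOp_innerPowMul]
    simp only [I, map_sub, map_add, map_smul, map_sum, lapOp_dilate, eulerOp_dilate,
      lineDerivOp_dilate, smul_eq_mul]
    have e : ∀ i, ((a i : ℝ) : 𝕜) * (((s k : ℝ) : 𝕜) *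
        J (innerPowMul a (n - 1) (dilate (s k) (∂_{basisVec i} χ)))) = ((s k : ℝ) : 𝕜) *
        (((a i : ℝ) : 𝕜) * J (innerPowMul a (n - 1) (dilate (s k) (∂_{basisVec i} χ)))) :=
      fun i => mul_left_comm _ _ _
    simp only [e, ← Finset.mul_sum]
    ring
  have hlim := (((((hI n χ).const_mul (c + n)).sub
    ((hI (n - 2) χ).const_mul ((n : 𝕜) * ((n - 1 : ℕ) : 𝕜) * ((‖a‖ ^ 2 : ℝ) : 𝕜)))).sub
    (hs'.mul ((tendsto_finsetSum Finset.univ fun i _ =>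
      (hI (n - 1) (∂_{basisVec i} χ)).const_mul ((a i : ℝ) : 𝕜)).const_mul (2 * (n : 𝕜))))).sub
    ((hs'.pow 2).mul (hI n (lapOp 𝕜 d χ)))).add (hI n (eulerOp 𝕜 d χ))
  have h0 := tendsto_nhds_unique hlim (tendsto_const_nhds.congr fun k => (key k).symm)
  -- The Euler term disappears because `x · ∇χ` vanishes at `x = 0`.
  rw [hχ, eulerOp_apply, (fderiv ℝ (χ : Rd d → 𝕜) 0).map_zero] at h0
  simp only [mul_one, zero_mul, mul_zero, sub_zero, add_zero, ne_eq, OfNat.ofNat_ne_zero,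
    not_false_eq_true, zero_pow] at h0
  exact sub_eq_zero.1 h0

/-- Strong induction on `n`: the recursion has the nonzero factor `c + n` on the left, and its right
side is zero for `n = 0` and by induction otherwise. -/
theorem moments_eq_zero {u : Rd d → 𝕜} (hu : MemLp u 2 (gauss d)) {c : ℝ} (hc : 0 < c)
    (h : ∀ f : 𝓢(Rd d, 𝕜), ∫ x, u x * ((c : 𝕜) • f - ouOp 𝕜 d f) x ∂(gauss d) = 0) (a : Rd d)
    (n : ℕ) : ∫ x, u x * (((inner ℝ a x) ^ n : ℝ) : 𝕜) ∂(gauss d) = 0 := by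
  induction n using Nat.strong_induction_on with
  | _ n ih =>
    have h1 := moment_recursion hu h a n
    have hcn : (c : 𝕜) + n ≠ 0 := by
      have : ((c + n : ℝ) : 𝕜) ≠ 0 := by
        rw [RCLike.ofReal_ne_zero]
        positivity
      simpa using this
    rcases n with _ | n
    · simpa [hc.ne'] using h1
    · rw [ih (n + 1 - 2) (by omega), mul_zero] at h1
      exact (mul_eq_zero.1 h1).resolve_left hcn

theorem hasDenseRange_ouOp : HasDenseRange (onSchwartz (gauss d) (ouOp 𝕜 d)) := by
  intro c hc z hz
  -- Conjugating `z` turns orthogonality to the range into the bilinear hypothesis of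
  -- `moments_eq_zero`.
  have hu : MemLp (fun x => (starRingEnd 𝕜) (z x)) 2 (gauss d) := (Lp.memLp z).star
  have h0 := ae_eq_zero_of_moments hu (moments_eq_zero hu hc fun f => by
    have h1 := hz _ _ ((mem_graph_onSchwartz_iff (gauss d) (ouOp 𝕜 d) (schwartzToL2 (gauss d) f)
      (schwartzToL2 (gauss d) (ouOp 𝕜 d f))).2 ⟨f, rfl, rfl⟩)
    rw [← map_smul, ← map_sub, L2.inner_def] at h1
    rw [← h1]
    refine integral_congr_ae ?_
    filter_upwards [((c : 𝕜) • f - ouOp 𝕜 d f).coeFn_toLp 2 (gauss d)] with x hx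
    rw [RCLike.inner_apply, mul_comm]
    congr 1
    exact hx.symm)
  refine Lp.ext ?_
  filter_upwards [h0, Lp.coeFn_zero 𝕜 2 (gauss d)] with x hx h2
  rw [h2]
  simpa using hx

end TestFunctions

/-! ### The closed operator and invariance of the Gaussian measure -/

section Closure

variable {𝕜 : Type*} [RCLike 𝕜] {d : ℕ}

theorem isClosable_ouOp : (onSchwartz (gauss d) (ouOp 𝕜 d)).IsClosable :=
  isGraphSymmetric_ouOp.isClosable (dense_domain_onSchwartz _ (ouOp 𝕜 d))

theorem dense_domain_closure_ouOp :
    Dense ((onSchwartz (gauss d) (ouOp 𝕜 d)).closure.domain : Set (Lp 𝕜 2 (gauss d))) :=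
  (dense_domain_onSchwartz _ (ouOp 𝕜 d)).mono (LinearPMap.le_closure _).1

theorem hasFullRange_closure_ouOp : HasFullRange (onSchwartz (gauss d) (ouOp 𝕜 d)).closure :=
  hasDenseRange_ouOp.hasFullRange_closure isDissipative_ouOp isClosable_ouOp

theorem inner_one_eq_integral (f : Lp 𝕜 2 (gauss d)) :
    inner 𝕜 (Lp.const 2 (gauss d) (1 : 𝕜)) f = ∫ x, f x ∂(gauss d) := by
  rw [L2.inner_def]
  refine integral_congr_ae ?_
  filter_upwards [Lp.coeFn_const (p := 2) (μ := gauss d) (1 : 𝕜)] with x hx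
  rw [hx, RCLike.inner_apply]
  simp

/-- Integration against `μ` is the continuous functional `⟪1, ·⟫`, so its vanishing on the range of
`L₀` passes to the closure. -/
theorem inner_one_closure_ouOp {x y : Lp 𝕜 2 (gauss d)}
    (hxy : (x, y) ∈ (onSchwartz (gauss d) (ouOp 𝕜 d)).closure.graph) :
    innerSL 𝕜 (Lp.const 2 (gauss d) (1 : 𝕜)) y = 0 := by
  refine mem_graph_closure_induction isClosable_ouOp
    (P := fun _ y => innerSL 𝕜 (Lp.const 2 (gauss d) (1 : 𝕜)) y = 0) ?_ ?_ hxy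
  · exact isClosed_eq ((innerSL 𝕜 _).continuous.comp continuous_snd) continuous_const
  · intro x y hxy
    obtain ⟨f, rfl, rfl⟩ := (mem_graph_onSchwartz_iff (gauss d) (ouOp 𝕜 d) x y).1 hxy
    rw [innerSL_apply_apply, inner_one_eq_integral, ← integral_ouOp_gauss f]
    exact integral_congr_ae ((ouOp 𝕜 d f).coeFn_toLp 2 (gauss d))

theorem isSemigroupInvariant_of_isGenerator {T : ℝ≥0 → Lp 𝕜 2 (gauss d) →L[𝕜] Lp 𝕜 2 (gauss d)}
    (hT : IsC0ContractionSemigroup T)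
    (hG : IsGenerator (onSchwartz (gauss d) (ouOp 𝕜 d)).closure T) :
    IsSemigroupInvariant (gauss d) T := by
  have hi : ∀ f : Lp 𝕜 2 (gauss d), Integrable (f : Rd d → 𝕜) (gauss d) := fun f =>
    (Lp.memLp f).integrable (by norm_num)
  refine fun t f => ⟨hi _, hi _, ?_⟩
  have h := hG.functional_invariant (dense_domain_closure_ouOp (𝕜 := 𝕜) (d := d)) hT
    (innerSL 𝕜 (Lp.const 2 (gauss d) (1 : 𝕜))) (fun x y hxy => inner_one_closure_ouOp hxy) t f
  rwa [innerSL_apply_apply, innerSL_apply_apply, inner_one_eq_integral,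
    inner_one_eq_integral] at h

end Closure

end OrnsteinUhlenbeck

end

theorem proposition2p15 {𝕜 : Type*} [RCLike 𝕜] (d : ℕ) :
    -- (1) the adjoint of `L₀` in `L²(dx)` is `Δ + x · ∇ + d`: it extends this operator on `S(ℝ^d)`,
    -- and in general it acts as this operator in the sense of distributions, on all `g ∈ L²(dx)`
    -- for which the result is in `L²(dx)`
    (Dense ((onSchwartz volume (ouOp 𝕜 d)).domain : Set (Lp 𝕜 2 (volume : Measure (Rd d)))) ∧
      onSchwartz volume (ouDualOp 𝕜 d) ≤ (onSchwartz volume (ouOp 𝕜 d)).adjoint ∧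
      ∀ g h : Lp 𝕜 2 (volume : Measure (Rd d)),
        (g, h) ∈ (onSchwartz volume (ouOp 𝕜 d)).adjoint.graph ↔ SolvesDualWeakly g h) ∧
    -- (2) `μ` is `(L₀, S(ℝ^d))`-invariant
    IsOperatorInvariant (gauss d) (onSchwartz (gauss d) (ouOp 𝕜 d)) ∧
    -- (3) the adjoint of `L₀` in `L²(μ)` equals `L₀` on `S(ℝ^d)`, so `L₀` is symmetric in `L²(μ)`
    IsSymmetricOp (onSchwartz (gauss d) (ouOp 𝕜 d)) ∧
    -- (4) `L₀` is closable in `L²(μ)` and its closure is self-adjoint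
    ((onSchwartz (gauss d) (ouOp 𝕜 d)).IsClosable ∧
      IsSelfAdjoint (onSchwartz (gauss d) (ouOp 𝕜 d)).closure) ∧
    -- (5) the closure generates exactly one strongly continuous contraction semigroup on `L²(μ)`,
    -- and `μ` is invariant under it
    ∃ T : ℝ≥0 → Lp 𝕜 2 (gauss d) →L[𝕜] Lp 𝕜 2 (gauss d),
      IsC0ContractionSemigroup T ∧
      IsGenerator (onSchwartz (gauss d) (ouOp 𝕜 d)).closure T ∧
      (∀ T' : ℝ≥0 → Lp 𝕜 2 (gauss d) →L[𝕜] Lp 𝕜 2 (gauss d),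
        IsC0ContractionSemigroup T' →
        IsGenerator (onSchwartz (gauss d) (ouOp 𝕜 d)).closure T' → T' = T) ∧
      IsSemigroupInvariant (gauss d) T := by
  have hdiss := (isDissipative_ouOp (𝕜 := 𝕜) (d := d)).closure isClosable_ouOp
  refine ⟨⟨dense_domain_onSchwartz _ (ouOp 𝕜 d), ouDualOp_le_adjoint, fun g h => ?_⟩,
    isOperatorInvariant_ouOp,
    isGraphSymmetric_ouOp.isSymmetricOp (dense_domain_onSchwartz _ (ouOp 𝕜 d)),
    ⟨isClosable_ouOp, ?_⟩, ?_⟩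
  · rw [mem_graph_adjoint_ouOp_iff, solvesDualWeakly_iff]
  · exact (isGraphSymmetric_ouOp.closure isClosable_ouOp).isSelfAdjoint_of_hasFullRange
      (dense_domain_closure_ouOp (𝕜 := 𝕜) (d := d)) hasFullRange_closure_ouOp
  · obtain ⟨T, hT, hG⟩ := exists_contractionSemigroup (dense_domain_closure_ouOp (𝕜 := 𝕜) (d := d)) hdiss
      (hasFullRange_closure_ouOp (𝕜 := 𝕜) (d := d))
    exact ⟨T, hT, hG, fun T' hT' hG' =>
      hG.unique (dense_domain_closure_ouOp (𝕜 := 𝕜) (d := d)) hdiss hT hT' hG',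
      isSemigroupInvariant_of_isGenerator hT hG⟩
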